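/- A pawn game consists of a finite set $V$ of vertices, a set $E\subseteq V\times V$ of directed edges, a set $T\subseteq V$ of targets of Player 1, and pawns $1,\dots,d$, where pawn $j$ owns a set $V_j\subseteq V$ and $V=V_1\cup\dots\cup V_d$. It is an OVPP (one vertex per pawn) game if there is a bijection $e:\{1,\dots,d\}\to V$ with $V_j=\{e(j)\}$ for all $j$. A configuration is a pair $\langle v,P\rangle$, where $v\in V$ is the position of a token and $P\subseteq\{1,\dots,d\}$ is the set of pawns that Player 1 controls; Player 2 controls the other pawns. From $\langle v,P\rangle$, Player 1 moves the token if $v\in V_j$ for some $j\in P$, and otherwise Player 2 does. The mover chooses an edge $(v,u)\in E$. Then, under the optional-grabbing mechanism, the other player may take over one pawn that the mover controls, or leave the control of the pawns unchanged; that is, if Player 1 moved, Player 2 chooses the next configuration among $\langle u,P\rangle$ and $\langle u,P\setminus\{j\}\rangle$ with $j\in P$, and if Player 2 moved, Player 1 chooses it among $\langle u,P\rangle$ and $\langle u,P\cup\{j\}\rangle$ with $j\notin P$. A play that arrives at a vertex without outgoing edges ends there. Player 1 wins a play if it visits a configuration $\langle v,P\rangle$ with $v\in T$. He wins from a configuration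 if he has a strategy that is memoryless on the positions of this game (the configurations, and the intermediate positions that consist of the previous configuration and the vertex to which the token was just moved) and that wins against all such strategies of Player 2. Theorem. OVPP optional-grabbing PAWN-GAMES is in PTIME: the problem to decide, given an OVPP pawn game and an initial configuration $\langle v_0,P_0\rangle$ (encoded as a string, with $E$ and the ownership of vertices given explicitly by incidence matrices), whether Player 1 wins from $\langle v_0,P_0\rangle$ under optional grabbing, is solved by a deterministic Turing machine whose running time is bounded by a polynomial in the length of the input. -/

import Mathlib

namespace PawnGames

/-- A turn-based reachability game on a vertex set `V`: Player 1 owns the vertices in `V₁`, Player 2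
owns the others, `E v u` says that there is an edge from `v` to `u`, and `T` is Player 1's target. -/
structure TurnBasedGame (V : Type) where
  V₁ : Set V
  E : V → V → Prop
  T : Set V

namespace TurnBasedGame

variable {V : Type} (G : TurnBasedGame V)

/-- `f` is a (memoryless) strategy of the player who owns the vertices in `A`: at each vertex of `A`
that has a neighbor, it selects a neighbor. Its values elsewhere are never used. -/
def IsStrategy (A : Set V) (f : V → V) : Prop :=
  ∀ v ∈ A, (∃ u, G.E v u) → G.E v (f v)

open Classical in
/-- The position after `v` when the players follow `f₁` and `f₂`. At a vertex without neighbors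
the play is over, and the token stays where it is. -/
noncomputable def next (f₁ f₂ : V → V) (v : V) : V :=
  if ∃ u, G.E v u then (if v ∈ G.V₁ then f₁ v else f₂ v) else v

/-- The play that the strategies `f₁` and `f₂` produce from `v₀`. -/
noncomputable def play (f₁ f₂ : V → V) (v₀ : V) (k : ℕ) : V :=
  (G.next f₁ f₂)^[k] v₀

/-- Player 1 wins from `v₀`: some strategy of his reaches the target against each strategy of
Player 2. -/
def Player1Wins (v₀ : V) : Prop :=
  ∃ f₁, G.IsStrategy G.V₁ f₁ ∧
    ∀ f₂, G.IsStrategy G.V₁ᶜ f₂ → ∃ k, G.play f₁ f₂ v₀ k ∈ G.T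

end TurnBasedGame

/-- The arena of a pawn game with vertex set `Fin n` and pawns `Fin d`. Pawn `j` owns the vertices in
`own j`, every vertex is owned by at least one pawn, `E` is the set of directed edges and `T` is
Player 1's target. -/
structure PawnGame (n d : ℕ) where
  own : Fin d → Finset (Fin n)
  own_cover : ∀ v, ∃ j, v ∈ own j
  E : Finset (Fin n × Fin n)
  T : Finset (Fin n)

/-- The vertices of the explicit turn-based game of a pawn game: configurations `⟨v, P⟩`, where the
token is on `v` and `P` is the set of pawns that Player 1 controls, and intermediate vertices
`⟨u, ⟨v, P⟩⟩`, where the token has just been moved to `u` from the configuration `⟨v, P⟩`. -/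
inductive Position (n d : ℕ) : Type
  | config (v : Fin n) (P : Finset (Fin d))
  | inter (u v : Fin n) (P : Finset (Fin d))

namespace PawnGame

variable {n d : ℕ} (G : PawnGame n d)

/-- One vertex per pawn: `j ↦ own j` is a one-to-one correspondence of pawns and vertices. -/
def IsOVPP : Prop :=
  ∃ e : Fin d ≃ Fin n, ∀ j, G.own j = {e j}

/-- Player 1 moves the token from `⟨v, P⟩` iff he controls at least one pawn that owns `v`. -/
def Player1Moves (v : Fin n) (P : Finset (Fin d)) : Prop :=
  ∃ j ∈ P, v ∈ G.own j

/-- The edges of the explicit game under the optional-grabbing mechanism: after a player has moved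
the token, the other player may grab one of the mover's pawns, or not grab. -/
inductive OptionalGrabbingEdge : Position n d → Position n d → Prop
  | move {v u : Fin n} {P : Finset (Fin d)} : (v, u) ∈ G.E →
      OptionalGrabbingEdge (.config v P) (.inter u v P)
  | noGrab {u v : Fin n} {P : Finset (Fin d)} :
      OptionalGrabbingEdge (.inter u v P) (.config u P)
  | grab₂ {u v : Fin n} {P : Finset (Fin d)} {j : Fin d} : G.Player1Moves v P → j ∈ P →
      OptionalGrabbingEdge (.inter u v P) (.config u (P.erase j))
  | grab₁ {u v : Fin n} {P : Finset (Fin d)} {j : Fin d} : ¬ G.Player1Moves v P → j ∉ P →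
      OptionalGrabbingEdge (.inter u v P) (.config u (insert j P))

/-- The explicit turn-based game of `G` under optional grabbing. -/
def optionalGrabbing : TurnBasedGame (Position n d) where
  V₁ := {x | match x with
    | .config v P => G.Player1Moves v P
    | .inter _ v P => ¬ G.Player1Moves v P}
  E := G.OptionalGrabbingEdge
  T := {x | ∃ v ∈ G.T, ∃ P, x = .config v P}

end PawnGame

/-- An input of the decision problem: a pawn game and an initial configuration. -/
structure Input where
  n : ℕ
  d : ℕ
  game : PawnGame n d
  token : Fin n
  pawns : Finset (Fin d)

namespace Input

/-- The description of the vertex `v`: whether the token starts on it, whether it is a target,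
the pawns that own it, and its neighbors. The symbol `none` is a separator. -/
def encodeVertex (I : Input) (v : Fin I.n) : List (Option Bool) :=
  some (decide (v = I.token)) :: some (decide (v ∈ I.game.T)) ::
    ((List.finRange I.d).map (fun j => some (decide (v ∈ I.game.own j))) ++ none ::
      ((List.finRange I.n).map (fun u => some (decide ((v, u) ∈ I.game.E))) ++ [none]))

/-- The input string: the pawns that Player 1 controls initially, then the vertices one by one. -/
def encode (I : Input) : List (Option Bool) :=
  (List.finRange I.d).map (fun j => some (decide (j ∈ I.pawns))) ++ none ::
    (List.finRange I.n).flatMap I.encodeVertex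

end Input

/-- A string has at most one decomposition into a separator-free part and the part that follows the
first separator. -/
theorem append_none_cons_inj {A A' : List Bool} {R R' : List (Option Bool)}
    (h : A.map some ++ none :: R = A'.map some ++ none :: R') : A = A' ∧ R = R' := by
  induction A generalizing A' with
  | nil => cases A' <;> simp_all
  | cons a A ih =>
    cases A' with
    | nil => simp at h
    | cons a' A' =>
      simp only [List.map_cons, List.cons_append, List.cons.injEq, Option.some.injEq] at h
      obtain ⟨h1, h2⟩ := ih h.2
      exact ⟨by rw [h.1, h1], h2⟩

/-- Different inputs have different input strings. -/
theorem Input.encode_injective : Function.Injective Input.encode := by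
  have key : ∀ (I : Input) (v : Fin I.n) (R : List (Option Bool)), I.encodeVertex v ++ R =
      (decide (v = I.token) :: decide (v ∈ I.game.T) ::
        (List.finRange I.d).map (fun j => decide (v ∈ I.game.own j))).map some ++ none ::
      (((List.finRange I.n).map (fun u => decide ((v, u) ∈ I.game.E))).map some ++ none :: R) := by
    intro I v R
    simp [Input.encodeVertex, Function.comp_def]
  have keyP : ∀ (I : Input), I.encode =
      ((List.finRange I.d).map (fun j => decide (j ∈ I.pawns))).map some ++ none ::
        (List.finRange I.n).flatMap I.encodeVertex := by
    intro I
    simp [Input.encode, Function.comp_def]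
  intro I I' h
  rw [keyP, keyP] at h
  obtain ⟨hP, hR⟩ := append_none_cons_inj h
  have hd : I.d = I'.d := by simpa using congrArg List.length hP
  have hn : I.n = I'.n := by
    have h0 := I.token.pos
    have h0' := I'.token.pos
    obtain ⟨n, d, G, v, P⟩ := I
    obtain ⟨n', d', G', v', P'⟩ := I'
    obtain ⟨m, rfl⟩ := Nat.exists_eq_succ_of_ne_zero h0.ne'
    obtain ⟨m', rfl⟩ := Nat.exists_eq_succ_of_ne_zero h0'.ne'
    simp only [Nat.succ_eq_add_one, List.finRange_succ, List.flatMap_cons, key] at hR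
    have := congrArg List.length (append_none_cons_inj (append_none_cons_inj hR).2).1
    simpa using this
  obtain ⟨n, d, ⟨own, hc, E, T⟩, v, P⟩ := I
  obtain ⟨n', d', ⟨own', hc', E', T'⟩, v', P'⟩ := I'
  dsimp only at hn hd
  subst hn hd
  have hrow : ∀ l : List (Fin n),
      l.flatMap (Input.encodeVertex ⟨n, d, ⟨own, hc, E, T⟩, v, P⟩) =
        l.flatMap (Input.encodeVertex ⟨n, d, ⟨own', hc', E', T'⟩, v', P'⟩) → ∀ x ∈ l,
      (x = v ↔ x = v') ∧ (x ∈ T ↔ x ∈ T') ∧ (∀ j, x ∈ own j ↔ x ∈ own' j) ∧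
        ∀ u, (x, u) ∈ E ↔ (x, u) ∈ E' := by
    intro l
    induction l with
    | nil => simp
    | cons y l ih =>
      intro hl
      rw [List.flatMap_cons, List.flatMap_cons, key, key] at hl
      obtain ⟨h1, h2⟩ := append_none_cons_inj hl
      obtain ⟨h3, h4⟩ := append_none_cons_inj h2
      intro x hx
      rcases List.mem_cons.1 hx with rfl | hx
      · simpa [List.map_inj_left, and_assoc] using And.intro h1 h3
      · exact ih h4 x hx
  have hall := fun x => hrow _ hR x (List.mem_finRange x)
  have e1 : v = v' := ((hall v).1).1 rfl
  have e2 : T = T' := Finset.ext fun x => (hall x).2.1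
  have e3 : own = own' := funext fun j => Finset.ext fun x => (hall x).2.2.1 j
  have e4 : E = E' := Finset.ext fun p => (hall p.1).2.2.2 p.2
  have e5 : P = P' := Finset.ext fun j => by
    simpa using List.map_inj_left.1 hP j (List.mem_finRange j)
  subst e1 e2 e3 e4 e5
  rfl

/-- OVPP optional-grabbing PAWN-GAMES, as a set of strings: the inputs whose pawn game is OVPP and
where Player 1 wins from the initial configuration under optional grabbing. -/
def ovppOptionalGrabbingPawnGames : Set (List (Option Bool)) :=
  {w | ∃ I : Input, I.encode = w ∧ I.game.IsOVPP ∧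
    I.game.optionalGrabbing.Player1Wins (.config I.token I.pawns)}

open Classical in
/-- The class PTIME: some deterministic (multi-stack) Turing machine halts on every string `w`, within
a number of steps that is polynomial in the length of `w`, with the output `true` if `w ∈ L` and
`false` otherwise. -/
def InPTIME {Γ : Type} (L : Set (List Γ)) : Prop :=
  Nonempty (Turing.TM2ComputableInPolyTime (id : List Γ → List Γ) Computability.encodeBool
    (fun w => decide (w ∈ L)))

end PawnGames

/-! With one vertex per pawn, a set of pawns is a set of vertices, so the explicit game has
exponentially many configurations. The proof shows that this set need not be remembered. Consider
the game whose state is only the token's vertex and who controls it: on arrival at `u`, the opponent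
of the mover may take `u` if it initially belongs to the mover, and `u` returns to its initial owner
when the token leaves. `FrozenWin` is the sequence of attractor stages of this game. Its states are
pairs of a vertex and a Boolean, so `FrozenWin.stationary` bounds the number of useful stages by
twice the number of vertices.

`PawnGame.player1Wins_optionalGrabbing_iff` proves that both games have the same winner. Player 2
takes only the vertex just entered, and only if Player 1 loses there under Player 2's control;
owning it for good is then harmless, since any later visit under this control is lost for Player 1
as well. Player 1 takes only the vertex just entered, and only if his control there wins at least as
early, in terms of stages, as Player 2's control; keeping it then never delays him. Comparing stages
rather than mere winning is what makes the stage drop along the play. In both cases an invariant on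
the changed pawns replaces the memory of the set, and it survives whatever the opponent grabs.

The stages are computed by sweeps over the adjacency matrix with two bits per vertex. The program is
written in a small while language over stacks with a time-counting semantics, which `Exec.reachesIn`
compiles to a multi-stack machine. `readAll_iff`, `Input.valid_iff_isOVPP` and
`Input.exists_of_valid` identify the strings that pass its checks with the encodings of OVPP inputs,
`any_answer_iff` identifies the sweeps with `FrozenWin`, and `exec_program` assembles correctness
and the cubic time bound. -/

namespace PawnGames

/-! ### Local and temporary grabbing: the attractor stages -/

/-- `FrozenWin E T p k v c`: Player 1 can force a visit to `T` within fewer than `k` moves from `v`,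
which he controls iff `c`, in the game where grabbing is local (only the vertex to which the token
was just moved can be grabbed) and temporary (a vertex `u` returns to its initial owner, Player 1
iff `p u`, once the token has left it). -/
def FrozenWin {V : Type} (E : V → V → Prop) (T p : V → Prop) : ℕ → V → Bool → Prop
  | 0, _, _ => False
  | k + 1, v, true => T v ∨ ∃ u, E v u ∧ FrozenWin E T p k u false ∧ (p u → FrozenWin E T p k u true)
  | k + 1, v, false => T v ∨ (∃ u, E v u) ∧
      ∀ u, E v u → FrozenWin E T p k u true ∨ (¬ p u ∧ FrozenWin E T p k u false)

namespace FrozenWin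

variable {V : Type} {E : V → V → Prop} {T p : V → Prop}

theorem succ (k : ℕ) : ∀ (v : V) (c : Bool),
    FrozenWin E T p k v c → FrozenWin E T p (k + 1) v c := by
  induction k with
  | zero => intro v c h; exact h.elim
  | succ k ih =>
    intro v c h
    cases c with
    | true =>
      rcases h with h | ⟨u, h1, h2, h3⟩
      · exact Or.inl h
      · exact Or.inr ⟨u, h1, ih _ _ h2, fun hp => ih _ _ (h3 hp)⟩
    | false =>
      rcases h with h | ⟨h1, h2⟩
      · exact Or.inl h
      · exact Or.inr ⟨h1, fun u hu => (h2 u hu).imp (ih _ _) fun h => ⟨h.1, ih _ _ h.2⟩⟩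

theorem mono {k l : ℕ} (hkl : k ≤ l) {v : V} {c : Bool} (h : FrozenWin E T p k v c) :
    FrozenWin E T p l v c := by
  induction hkl with
  | refl => exact h
  | step _ ih => exact succ _ _ _ ih

/-- The level `k + 1` is a function of the level `k`. -/
theorem succ_congr {k l : ℕ} (h : ∀ v c, FrozenWin E T p k v c ↔ FrozenWin E T p l v c) :
    ∀ v c, FrozenWin E T p (k + 1) v c ↔ FrozenWin E T p (l + 1) v c := by
  intro v c
  cases c <;> simp only [FrozenWin, h]

/-- The levels are stationary from twice the number of vertices on. -/
theorem stationary [Fintype V] {k : ℕ} {v : V} {c : Bool} (h : FrozenWin E T p k v c) :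
    FrozenWin E T p (2 * Fintype.card V) v c := by
  classical
  -- A growing chain of subsets of `V × Bool`, each determined by its predecessor, is constant after
  -- its first repetition, and it can grow strictly at most `2 * card V` times.
  let S : ℕ → Finset (V × Bool) := fun k => Finset.univ.filter fun x => FrozenWin E T p k x.1 x.2
  have hS : Monotone S := fun a b hab x hx => by
    simp only [S, Finset.mem_filter, Finset.mem_univ, true_and] at hx ⊢
    exact mono hab hx
  have hcong : ∀ a b, S a = S b → S (a + 1) = S (b + 1) := by
    intro a b hab
    have h1 : ∀ v c, FrozenWin E T p a v c ↔ FrozenWin E T p b v c := fun v c => by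
      simpa [S] using Finset.ext_iff.1 hab (v, c)
    ext x
    simpa [S] using succ_congr h1 x.1 x.2
  rcases le_total k (2 * Fintype.card V) with hk | hk
  · exact mono hk h
  have hcard : (S k).card = (S (2 * Fintype.card V)).card := by
    refine Nat.stabilises_of_monotone (f := fun k => (S k).card)
      (fun a b hab => Finset.card_le_card (hS hab)) (fun m => ?_) (fun m hm => ?_) hk
    · refine (Finset.card_le_univ _).trans_eq ?_
      simp [mul_comm]
    · have := Finset.eq_of_subset_of_card_le (hS m.le_succ) hm.ge
      exact congrArg Finset.card (hcong _ _ this)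
  have := Finset.eq_of_subset_of_card_le (hS hk) hcard.le
  have hx : (v, c) ∈ S k := by simpa [S] using h
  rw [← this] at hx
  simpa [S] using hx

end FrozenWin

/-! ### Optional grabbing is equivalent to local and temporary grabbing -/

namespace PawnGame

open Classical in
/-- Under one vertex per pawn, Player 1 wins under optional grabbing iff he wins the game with local
and temporary grabbing. -/
theorem player1Wins_optionalGrabbing_iff {n d : ℕ} (G : PawnGame n d) (e : Fin d ≃ Fin n)
    (he : ∀ j, G.own j = {e j}) (v₀ : Fin n) (P₀ : Finset (Fin d)) :
    G.optionalGrabbing.Player1Wins (.config v₀ P₀) ↔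
      FrozenWin (fun v u => (v, u) ∈ G.E) (· ∈ G.T) (fun u => e.symm u ∈ P₀) (2 * n) v₀
        (decide (e.symm v₀ ∈ P₀)) := by
  have hmoves : ∀ v P, G.Player1Moves v P ↔ e.symm v ∈ P := by
    intro v P
    constructor
    · rintro ⟨j, hj, hv⟩
      rw [he, Finset.mem_singleton] at hv
      simpa [hv] using hj
    · intro h
      exact ⟨_, h, by simp [he]⟩
  set W := FrozenWin (fun v u => (v, u) ∈ G.E) (· ∈ G.T) (fun u => e.symm u ∈ P₀) with hW
  have hstat : ∀ {k v c}, W k v c → W (2 * n) v c := by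
    intro k v c h
    simpa using h.stationary
  have hinterE : ∀ {u v P y}, G.optionalGrabbing.E (.inter u v P) y →
      ∃ P', y = .config u P' ∧ (P' = P ∨ (e.symm v ∈ P ∧ ∃ j, P' = P.erase j) ∨
        (e.symm v ∉ P ∧ ∃ j, P' = insert j P)) := by
    intro u v P y h
    cases h with
    | noGrab => exact ⟨_, rfl, Or.inl rfl⟩
    | grab₂ h1 h2 => exact ⟨_, rfl, Or.inr (Or.inl ⟨(hmoves _ _).1 h1, _, rfl⟩)⟩
    | grab₁ h1 h2 => exact ⟨_, rfl, Or.inr (Or.inr ⟨fun h => h1 ((hmoves _ _).2 h), _, rfl⟩)⟩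
  have hconfE : ∀ {v P y}, G.optionalGrabbing.E (.config v P) y →
      ∃ u, y = .inter u v P ∧ (v, u) ∈ G.E := by
    intro v P y h
    cases h with
    | move h => exact ⟨_, rfl, h⟩
  have hV1 : ∀ v P, (Position.config v P) ∈ G.optionalGrabbing.V₁ ↔ e.symm v ∈ P :=
    fun v P => hmoves v P
  have hV1' : ∀ u v P, (Position.inter u v P) ∈ G.optionalGrabbing.V₁ ↔ e.symm v ∉ P :=
    fun u v P => not_congr (hmoves v P)
  have hT : ∀ v P, (Position.config v P) ∈ G.optionalGrabbing.T ↔ v ∈ G.T := by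
    intro v P
    simp [optionalGrabbing]
  have hT' : ∀ u v P, (Position.inter u v P) ∉ G.optionalGrabbing.T := by
    intro u v P
    simp [optionalGrabbing]
  have hex : ∀ u v P, ∃ y, G.optionalGrabbing.E (.inter u v P) y :=
    fun u v P => ⟨_, OptionalGrabbingEdge.noGrab⟩
  have hex' : ∀ v P, (∃ y, G.optionalGrabbing.E (.config v P) y) ↔ ∃ u, (v, u) ∈ G.E :=
    fun v P => ⟨fun ⟨y, hy⟩ => (hconfE hy).imp fun _ h => h.2,
      fun ⟨u, hu⟩ => ⟨_, OptionalGrabbingEdge.move hu⟩⟩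
  constructor
  · contrapose
    intro hlose
    rintro ⟨f₁, hf₁, hwin⟩
    -- By `hstat`, level `2 * n + 1` is contained in level `2 * n`, so losing at `L` unfolds to a
    -- one-step condition that speaks of `L` again.
    set L := W (2 * n) with hL
    have hLt : ∀ v, ¬ L v true → v ∉ G.T ∧
        ∀ u, (v, u) ∈ G.E → ¬ L u false ∨ (e.symm u ∈ P₀ ∧ ¬ L u true) := by
      intro v hv
      have h1 : ¬ W (2 * n + 1) v true := fun h => hv (hstat h)
      simp only [hW, FrozenWin, not_or, not_exists, not_and] at h1
      refine ⟨h1.1, fun u hu => ?_⟩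
      by_contra hc
      push Not at hc
      exact h1.2 u hu hc.1 hc.2
    have hLf : ∀ v, ¬ L v false → v ∉ G.T ∧ ((∃ u, (v, u) ∈ G.E) →
        ∃ u, (v, u) ∈ G.E ∧ ¬ L u true ∧ (e.symm u ∉ P₀ → ¬ L u false)) := by
      intro v hv
      have h1 : ¬ W (2 * n + 1) v false := fun h => hv (hstat h)
      simp only [hW, FrozenWin, not_or, not_and] at h1
      refine ⟨h1.1, fun hu => ?_⟩
      have := h1.2 hu
      push Not at this
      obtain ⟨u, hu, h2, h3⟩ := this
      exact ⟨u, hu, h2, h3⟩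
    have hm : ∀ v, ∃ u, (∃ u, (v, u) ∈ G.E) → (v, u) ∈ G.E ∧ (¬ L v false →
        ¬ L u true ∧ (e.symm u ∉ P₀ → ¬ L u false)) := by
      intro v
      by_cases h : ∃ u, (v, u) ∈ G.E
      · by_cases hv : L v false
        · obtain ⟨u, hu⟩ := h
          exact ⟨u, fun _ => ⟨hu, fun h => (h hv).elim⟩⟩
        · obtain ⟨u, hu, h1, h2⟩ := (hLf v hv).2 h
          exact ⟨u, fun _ => ⟨hu, fun _ => ⟨h1, h2⟩⟩⟩
      · exact ⟨v, fun h' => (h h').elim⟩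
    choose m hm using hm
    -- Player 2 grabs only the pawn of the vertex just entered, and only if his control there makes
    -- Player 1 lose.
    let f₂ : Position n d → Position n d := fun x => match x with
      | .config v P => .inter (m v) v P
      | .inter u v P => if e.symm v ∈ P ∧ e.symm u ∈ P ∧ ¬ L u false
          then .config u (P.erase (e.symm u)) else .config u P
    have hf₂ : G.optionalGrabbing.IsStrategy G.optionalGrabbing.V₁ᶜ f₂ := by
      rintro (⟨v, P⟩ | ⟨u, v, P⟩) _ hne
      · exact OptionalGrabbingEdge.move (hm v ((hex' _ _).1 hne)).1
      · simp only [f₂]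
        split_ifs with h
        · exact OptionalGrabbingEdge.grab₂ ((hmoves _ _).2 h.1) h.2.1
        · exact OptionalGrabbingEdge.noGrab
    -- The permanence of grabs is harmless to Player 2: wherever Player 1 has lost an initial pawn,
    -- Player 2's control makes Player 1 lose. The pawns that Player 1 has gained need no condition.
    let J : Finset (Fin d) → Prop := fun P => ∀ u, e.symm u ∈ P₀ → e.symm u ∉ P → ¬ L u false
    let Safe : Position n d → Prop := fun x => match x with
      | .config v P => J P ∧ ¬ L v (decide (e.symm v ∈ P))
      | .inter u v P => J P ∧ if e.symm v ∈ P then ¬ L u false ∨ (e.symm u ∈ P₀ ∧ ¬ L u true)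
          else ¬ L u true ∧ (e.symm u ∉ P₀ → ¬ L u false)
    have hstep : ∀ x, Safe x → Safe (G.optionalGrabbing.next f₁ f₂ x) := by
      rintro (⟨v, P⟩ | ⟨u, v, P⟩) hx
      · by_cases hne : ∃ y, G.optionalGrabbing.E (.config v P) y
        · rw [TurnBasedGame.next, if_pos hne]
          by_cases hv : e.symm v ∈ P
          · rw [if_pos ((hV1 _ _).2 hv)]
            obtain ⟨u, hu, huE⟩ := hconfE (hf₁ _ ((hV1 _ _).2 hv) hne)
            rw [hu]
            refine ⟨hx.1, ?_⟩
            rw [if_pos hv]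
            exact (hLt v (by simpa [hv] using hx.2)).2 u huE
          · rw [if_neg (mt (hV1 _ _).1 hv)]
            refine ⟨hx.1, ?_⟩
            rw [if_neg hv]
            exact (hm v ((hex' _ _).1 hne)).2 (by simpa [hv] using hx.2)
        · rw [TurnBasedGame.next, if_neg hne]
          exact hx
      · rw [TurnBasedGame.next, if_pos (hex u v P)]
        obtain ⟨hJ, hx⟩ := hx
        by_cases hv : e.symm v ∈ P
        · rw [if_neg (by rw [hV1']; simpa using hv)]
          rw [if_pos hv] at hx
          simp only [f₂]
          split_ifs with h
          · refine ⟨fun w hw hw' => ?_, ?_⟩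
            · by_cases hwu : w = u
              · exact hwu ▸ h.2.2
              · exact hJ w hw fun hwP => hw' (Finset.mem_erase.2 ⟨by simpa using hwu, hwP⟩)
            · simpa using h.2.2
          · refine ⟨hJ, ?_⟩
            by_cases hu : e.symm u ∈ P
            · have hLu : L u false := by
                by_contra hc
                exact h ⟨hv, hu, hc⟩
              rcases hx with hx | hx
              · exact (hx hLu).elim
              · simpa [hu] using hx.2
            · rcases hx with hx | hx
              · simpa [hu] using hx
              · simpa [hu] using hJ u hx.1 hu
        · have hv1 := (hV1' u v P).2 hv
          rw [if_pos hv1]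
          rw [if_neg hv] at hx
          obtain ⟨P', hP', h⟩ := hinterE (hf₁ _ hv1 (hex u v P))
          -- Here Player 1 can only gain pawns, so `J` is preserved even if he grabs a pawn
          -- elsewhere.
          have hsub : P ⊆ P' := by
            rcases h with rfl | h | ⟨_, j, rfl⟩
            · exact subset_rfl
            · exact (hv h.1).elim
            · exact Finset.subset_insert _ _
          have hJ' : J P' := fun w hw hw' => hJ w hw fun h => hw' (hsub h)
          rw [hP']
          refine ⟨hJ', ?_⟩
          by_cases hu : e.symm u ∈ P'
          · simpa [hu] using hx.1
          · simp only [hu, decide_false]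
            by_cases hu0 : e.symm u ∈ P₀
            · exact hJ' u hu0 hu
            · exact hx.2 hu0
    obtain ⟨k, hk⟩ := hwin f₂ hf₂
    have hsafe : Safe (G.optionalGrabbing.play f₁ f₂ (.config v₀ P₀) k) := by
      clear hk
      induction k with
      | zero => exact ⟨fun u h1 h2 => (h2 h1).elim, hlose⟩
      | succ k ih =>
        rw [TurnBasedGame.play, Function.iterate_succ_apply']
        exact hstep _ ih
    revert hk hsafe
    generalize G.optionalGrabbing.play f₁ f₂ (.config v₀ P₀) k = x
    rcases x with ⟨v, P⟩ | ⟨u, v, P⟩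
    · rintro hk ⟨-, hs⟩
      rw [hT] at hk
      cases hc : decide (e.symm v ∈ P) <;> rw [hc] at hs
      · exact (hLf v hs).1 hk
      · exact (hLt v hs).1 hk
    · intro hk
      exact (hT' _ _ _ hk).elim
  · intro hwin
    -- A successor chosen for the least level at which `v` is won serves all higher levels too. This
    -- makes Player 1's strategy memoryless.
    have hm : ∀ v, ∃ u, (∃ u, (v, u) ∈ G.E) → (v, u) ∈ G.E ∧ ∀ k, W k v true → v ∉ G.T →
        ∃ l < k, W l u false ∧ (e.symm u ∈ P₀ → W l u true) := by
      intro v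
      by_cases h : (∃ k, W k v true) ∧ v ∉ G.T
      · obtain ⟨h, hvT⟩ := h
        have hk := Nat.find_spec h
        have hmin := fun k => Nat.find_min' h (m := k)
        revert hk hmin
        generalize Nat.find h = k₀
        intro hk hmin
        cases k₀ with
        | zero => exact hk.elim
        | succ l =>
          rcases hk with hk | ⟨u, hu, h1, h2⟩
          · exact (hvT hk).elim
          · exact ⟨u, fun _ => ⟨hu, fun k hk _ => ⟨l, hmin k hk, h1, h2⟩⟩⟩
      · by_cases hne : ∃ u, (v, u) ∈ G.E
        · obtain ⟨u, hu⟩ := hne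
          exact ⟨u, fun _ => ⟨hu, fun k hk hv => (h ⟨⟨k, hk⟩, hv⟩).elim⟩⟩
        · exact ⟨v, fun h' => (hne h').elim⟩
    choose m hm using hm
    -- The test for grabbing `u` asks that his control wins at every level at which Player 2's
    -- control does, so that the grab can be kept.
    let f₁ : Position n d → Position n d := fun x => match x with
      | .config v P => .inter (m v) v P
      | .inter u v P => if e.symm v ∉ P ∧ e.symm u ∉ P ∧ ∀ k, W k u false → W k u true
          then .config u (insert (e.symm u) P) else .config u P
    have hf₁ : G.optionalGrabbing.IsStrategy G.optionalGrabbing.V₁ f₁ := by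
      rintro (⟨v, P⟩ | ⟨u, v, P⟩) _ hne
      · exact OptionalGrabbingEdge.move (hm v ((hex' _ _).1 hne)).1
      · simp only [f₁]
        split_ifs with h
        · exact OptionalGrabbingEdge.grab₁ (mt (hmoves _ _).1 h.1) h.2.1
        · exact OptionalGrabbingEdge.noGrab
    refine ⟨f₁, hf₁, fun f₂ hf₂ => ?_⟩
    -- Pawns that Player 1 has gained need not return to Player 2, since they never raise the level
    -- at which he wins. The pawns that he has lost need no condition.
    let Inv : Finset (Fin d) → Prop := fun P =>
      ∀ u, e.symm u ∈ P → e.symm u ∉ P₀ → ∀ k, W k u false → W k u true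
    have hplay2 : ∀ {x y z}, G.optionalGrabbing.next f₁ f₂ x = y →
        G.optionalGrabbing.next f₁ f₂ y = z →
        (∃ k, G.optionalGrabbing.play f₁ f₂ z k ∈ G.optionalGrabbing.T) →
        ∃ k, G.optionalGrabbing.play f₁ f₂ x k ∈ G.optionalGrabbing.T := by
      rintro x y z rfl rfl ⟨k, hk⟩
      exact ⟨k + 2, hk⟩
    -- Each round of two edges, a move and a grabbing decision, strictly lowers the level `k`.
    have key : ∀ k v P, Inv P → W k v (decide (e.symm v ∈ P)) →
        ∃ k, G.optionalGrabbing.play f₁ f₂ (.config v P) k ∈ G.optionalGrabbing.T := by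
      intro k
      induction k using Nat.strong_induction_on with
      | _ k ih =>
      intro v P hI hk
      by_cases hvT : v ∈ G.T
      · exact ⟨0, (hT v P).2 hvT⟩
      by_cases hv : e.symm v ∈ P
      · simp only [hv, decide_true] at hk
        have hne : ∃ u, (v, u) ∈ G.E := by
          cases k with
          | zero => exact hk.elim
          | succ k =>
            rcases hk with hk | ⟨u, hu, -⟩
            · exact (hvT hk).elim
            · exact ⟨u, hu⟩
        obtain ⟨l, hl, h1, h2⟩ := (hm v hne).2 k hk hvT
        have hnv : (Position.inter (m v) v P) ∉ G.optionalGrabbing.V₁ := by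
          rw [hV1']
          simpa using hv
        obtain ⟨P', hP', h⟩ := hinterE (hf₂ _ hnv (hex (m v) v P))
        have hsub : P' ⊆ P := by
          rcases h with rfl | ⟨_, j, rfl⟩ | h
          · exact subset_rfl
          · exact Finset.erase_subset _ _
          · exact (h.1 hv).elim
        refine hplay2 (y := .inter (m v) v P) (z := .config (m v) P') ?_ ?_
          (ih l hl _ _ (fun u hu => hI u (hsub hu)) ?_)
        · rw [TurnBasedGame.next, if_pos ((hex' v P).2 hne), if_pos ((hV1 _ _).2 hv)]
        · rw [TurnBasedGame.next, if_pos (hex _ _ _), if_neg hnv, hP']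
        · by_cases hu : e.symm (m v) ∈ P'
          · simp only [hu, decide_true]
            by_cases hu0 : e.symm (m v) ∈ P₀
            · exact h2 hu0
            · exact hI _ (hsub hu) hu0 _ h1
          · simpa only [hu, decide_false] using h1
      · simp only [hv, decide_false] at hk
        cases k with
        | zero => exact hk.elim
        | succ l =>
        rcases hk with hk | ⟨hne, hk⟩
        · exact (hvT hk).elim
        have hnv : (Position.config v P) ∉ G.optionalGrabbing.V₁ := mt (hV1 v P).1 hv
        obtain ⟨u, hu, huE⟩ := hconfE (hf₂ _ hnv ((hex' v P).2 hne))
        refine hplay2 (y := .inter u v P) ?_ rfl ?_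
        · rw [TurnBasedGame.next, if_pos ((hex' v P).2 hne), if_neg hnv, hu]
        · rw [TurnBasedGame.next, if_pos (hex _ _ _), if_pos ((hV1' _ _ _).2 hv)]
          simp only [f₁]
          have hku := hk u huE
          split_ifs with h
          · refine ih l (Nat.lt_succ_self l) _ _ (fun w hw hw0 => ?_) ?_
            · rcases Finset.mem_insert.1 hw with hw | hw
              · rw [e.symm.injective hw]
                exact h.2.2
              · exact hI w hw hw0
            · simp only [Finset.mem_insert_self, decide_true]
              exact hku.elim id fun h' => h.2.2 _ h'.2
          · refine ih l (Nat.lt_succ_self l) _ _ hI ?_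
            by_cases huP : e.symm u ∈ P
            · simp only [huP, decide_true]
              exact hku.elim id fun h' => hI u huP h'.1 _ h'.2
            · simp only [huP, decide_false]
              -- Player 1 declined to grab `u`, so at some level `u` is won under Player 2's control
              -- but not under his own. By monotonicity, a win at level `l` under his own control
              -- then implies one under Player 2's.
              have : ∃ k, W k u false ∧ ¬ W k u true := by
                by_contra hc
                push Not at hc
                exact h ⟨hv, huP, hc⟩
              obtain ⟨k', hk1, hk2⟩ := this
              rcases hku with h' | h'
              · refine hk1.mono ?_
                by_contra hc
                exact hk2 (h'.mono (not_le.1 hc).le)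
              · exact h'.2
    exact key _ _ _ (fun u h1 h2 => (h2 h1).elim) hwin

end PawnGame
end PawnGames

/-! ### While programs on stacks and their compilation to a multi-stack machine -/

namespace StackProgram

open Turing.TM2

variable {K : Type} [DecidableEq K] {Γ : K → Type} {σ M : Type}
  {var : M → σ} {stk : M → ∀ k, List (Γ k)}

/-- A piece of loop-free code of a multi-stack machine, together with its effect on the memory `M`,
whose internal state and stacks are read off by `var` and `stk`. -/
structure Block (var : M → σ) (stk : M → ∀ k, List (Γ k)) where
  code : ∀ {Λ : Type}, Stmt Γ Λ σ → Stmt Γ Λ σ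
  run : M → M
  sound : ∀ {Λ : Type} (q : Stmt Γ Λ σ) (m : M),
    stepAux (code q) (var m) (stk m) = stepAux q (var (run m)) (stk (run m))

namespace Block

/-- Run one block after the other. -/
def comp (a b : Block var stk) : Block var stk where
  code q := a.code (b.code q)
  run m := b.run (a.run m)
  sound q m := by rw [a.sound, b.sound]

/-- Run one of two blocks, depending on the internal state. -/
def branch (p : σ → Bool) (a b : Block var stk) : Block var stk where
  code q := .branch p (a.code q) (b.code q)
  run m := if p (var m) then a.run m else b.run m
  sound q m := by
    cases h : p (var m) <;> simp [h, a.sound, b.sound]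

end Block

/-- While programs over blocks. -/
inductive Cmd (var : M → σ) (stk : M → ∀ k, List (Γ k)) : Type 1
  | block (b : Block var stk) : Cmd var stk
  | seq (c c' : Cmd var stk) : Cmd var stk
  | ite (p : σ → Bool) (c c' : Cmd var stk) : Cmd var stk
  /-- Run `b`, then leave the loop unless `p` holds, then run `c` and repeat. -/
  | loop (b : Block var stk) (p : σ → Bool) (c : Cmd var stk) : Cmd var stk

/-- `Exec c m m' t`: the program `c` turns the memory `m` into `m'` in at most `t` steps. -/
inductive Exec : Cmd var stk → M → M → ℕ → Prop
  | block {b : Block var stk} {m m' : M} (h : b.run m = m') : Exec (.block b) m m' 1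
  | seq {c c' : Cmd var stk} {m m' m'' : M} {t t' : ℕ} : Exec c m m' t → Exec c' m' m'' t' →
      Exec (.seq c c') m m'' (t + t')
  | iteTrue {p : σ → Bool} {c c' : Cmd var stk} {m m' : M} {t : ℕ} : p (var m) = true →
      Exec c m m' t → Exec (.ite p c c') m m' (t + 1)
  | iteFalse {p : σ → Bool} {c c' : Cmd var stk} {m m' : M} {t : ℕ} : p (var m) = false →
      Exec c' m m' t → Exec (.ite p c c') m m' (t + 1)
  | loopDone {b : Block var stk} {p : σ → Bool} {c : Cmd var stk} {m m' : M} : b.run m = m' →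
      p (var m') = false → Exec (.loop b p c) m m' 1
  | loopStep {b : Block var stk} {p : σ → Bool} {c : Cmd var stk} {m m₁ m' m'' : M} {t t' : ℕ} :
      b.run m = m₁ → p (var m₁) = true → Exec c m₁ m' t → Exec (.loop b p c) m' m'' t' →
      Exec (.loop b p c) m m'' (t + t' + 1)
  | mono {c : Cmd var stk} {m m' : M} {t t' : ℕ} : t ≤ t' → Exec c m m' t → Exec c m m' t'

namespace Cmd

/-- The program points of a program. -/
def Label : Cmd var stk → Type
  | block _ => Unit
  | seq c c' => c.Label ⊕ c'.Label
  | ite _ c c' => Option (c.Label ⊕ c'.Label)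
  | loop _ _ c => Option c.Label

/-- A program has finitely many program points. -/
@[reducible]
def labelFintype : ∀ c : Cmd var stk, Fintype c.Label
  | block _ => inferInstanceAs (Fintype Unit)
  | seq c c' =>
    haveI := c.labelFintype
    haveI := c'.labelFintype
    inferInstanceAs (Fintype (c.Label ⊕ c'.Label))
  | ite _ c c' =>
    haveI := c.labelFintype
    haveI := c'.labelFintype
    inferInstanceAs (Fintype (Option (c.Label ⊕ c'.Label)))
  | loop _ _ c =>
    haveI := c.labelFintype
    inferInstanceAs (Fintype (Option c.Label))

/-- The program point where the execution starts. -/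
def entry : ∀ c : Cmd var stk, c.Label
  | block _ => ()
  | seq c _ => .inl c.entry
  | ite _ _ _ => none
  | loop _ _ _ => none

/-- The code at each program point, inside a machine with labels `Λ`, where the program points are
embedded by `emb`, and the program is followed by the code at `next`. -/
def code {Λ : Type} : ∀ c : Cmd var stk, (c.Label → Λ) → Λ → c.Label → Stmt Γ Λ σ
  | block b, _, next, _ => b.code (.goto fun _ => next)
  | seq c c', emb, _, .inl l => c.code (fun l => emb (.inl l)) (emb (.inr c'.entry)) l
  | seq _ c', emb, next, .inr l => c'.code (fun l => emb (.inr l)) next l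
  | ite p c c', emb, _, none =>
    .branch p (.goto fun _ => emb (some (.inl c.entry))) (.goto fun _ => emb (some (.inr c'.entry)))
  | ite _ c _, emb, next, some (.inl l) => c.code (fun l => emb (some (.inl l))) next l
  | ite _ _ c', emb, next, some (.inr l) => c'.code (fun l => emb (some (.inr l))) next l
  | loop b p c, emb, next, none =>
    b.code (.branch p (.goto fun _ => emb (some c.entry)) (.goto fun _ => next))
  | loop _ _ c, emb, _, some l => c.code (fun l => emb (some l)) (emb none) l

end Cmd

/-- The configuration at a program point. -/
def cfg {Λ : Type} (var : M → σ) (stk : M → ∀ k, List (Γ k)) (l : Λ) (m : M) : Cfg Γ Λ σ :=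
  ⟨some l, var m, stk m⟩

/-- `c'` follows `c` after at most `t` steps. -/
def ReachesIn {Λ : Type} (mach : Λ → Stmt Γ Λ σ) (c c' : Cfg Γ Λ σ) (t : ℕ) : Prop :=
  ∃ s ≤ t, (flip bind (step mach))^[s] (some c) = some c'

namespace ReachesIn

variable {Λ : Type} {mach : Λ → Stmt Γ Λ σ} {c c' c'' : Cfg Γ Λ σ} {t t' : ℕ}

theorem trans (h : ReachesIn mach c c' t) (h' : ReachesIn mach c' c'' t') :
    ReachesIn mach c c'' (t + t') := by
  obtain ⟨s, hs, h⟩ := h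
  obtain ⟨s', hs', h'⟩ := h'
  exact ⟨s' + s, by omega, by rw [Function.iterate_add_apply, h, h']⟩

theorem single (h : step mach c = some c') : ReachesIn mach c c' 1 :=
  ⟨1, le_rfl, h⟩

end ReachesIn

/-- A machine that contains the code of a program does what the program does. -/
theorem Exec.reachesIn {c : Cmd var stk} {m m' : M} {t : ℕ} (h : Exec c m m' t) {Λ : Type}
    {mach : Λ → Stmt Γ Λ σ} {emb : c.Label → Λ} {next : Λ}
    (hm : ∀ l, mach (emb l) = c.code emb next l) :
    ReachesIn mach (cfg var stk (emb c.entry) m) (cfg var stk next m') t := by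
  induction h generalizing next with
  | @block b m m' h =>
    subst h
    -- `Turing.TM2.step` executes all statements up to the next jump, so a whole block costs one
    -- step.
    apply ReachesIn.single
    rw [cfg, step, hm, Cmd.code, b.sound]
    rfl
  | seq _ _ ih ih' => exact (ih fun l => hm (.inl l)).trans (ih' fun l => hm (.inr l))
  | @iteTrue p c c' m m' t hp _ ih =>
    rw [add_comm]
    refine (ReachesIn.single ?_).trans (ih (emb := fun l => emb (some (.inl l)))
      fun l => hm (some (.inl l)))
    rw [cfg, step, hm, Cmd.entry, Cmd.code]
    simp [hp, cfg]
  | @iteFalse p c c' m m' t hp _ ih =>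
    rw [add_comm]
    refine (ReachesIn.single ?_).trans (ih (emb := fun l => emb (some (.inr l)))
      fun l => hm (some (.inr l)))
    rw [cfg, step, hm, Cmd.entry, Cmd.code]
    simp [hp, cfg]
  | @loopDone b p c m m' h hp =>
    subst h
    apply ReachesIn.single
    rw [cfg, step, hm, Cmd.entry, Cmd.code, b.sound]
    simp [hp, cfg]
  | @loopStep b p c m m₁ m' m'' t t' h hp _ _ ih ih' =>
    subst h
    rw [add_comm]
    refine (ReachesIn.single ?_).trans ((ih (emb := fun l => emb (some l)) (next := emb none)
      fun l => hm (some l)).trans (ih' hm))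
    rw [cfg, step, hm, Cmd.entry, Cmd.code, b.sound]
    simp [hp, cfg]
  | mono hle _ ih =>
    obtain ⟨s, hs, h⟩ := ih hm
    exact ⟨s, hs.trans hle, h⟩

/-- The machine that executes a program and halts. -/
def machine [Fintype K] [Fintype σ] (c : Cmd var stk) (k₀ k₁ : K) [Fintype (Γ k₀)] (init : σ) :
    Turing.FinTM2 where
  K := K
  k₀ := k₀
  k₁ := k₁
  Γ := Γ
  Λ := Option c.Label
  main := some c.entry
  ΛFin := haveI := c.labelFintype; inferInstanceAs (Fintype (Option c.Label))
  σ := σ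
  initialState := init
  m l := match l with
    | none => .halt
    | some l => c.code some none l

/-- Brings the dependent conditional in `Turing.initList` and `Turing.haltList` into the form in
which the stacks of a memory are specified. -/
theorem dite_eq_update (k₀ : K) (s : List (Γ k₀)) :
    (fun k => if h : k = k₀ then (by rw [h]; exact s : List (Γ k)) else []) =
      Function.update (fun _ => []) k₀ s := by
  funext k
  by_cases hk : k = k₀
  · subst hk
    simp
  · simp [hk]

/-- A program that turns each input into the corresponding output in polynomial time shows that a
function is computable in polynomial time. -/
theorem nonempty_computableInPolyTime [Fintype K] [Fintype σ] (c : Cmd var stk) (k₀ k₁ : K)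
    [Fintype (Γ k₀)] (init : σ) {α β αΓ βΓ : Type} {ea : α → List αΓ} {eb : β → List βΓ} {f : α → β}
    (e₀ : Γ k₀ ≃ αΓ) (e₁ : Γ k₁ ≃ βΓ) (start : α → M) (final : β → M) (time : Polynomial ℕ)
    (hvar : ∀ a, var (start a) = init) (hvar' : ∀ b, var (final b) = init)
    (hstk : ∀ a, stk (start a) = Function.update (fun _ => []) k₀ ((ea a).map e₀.symm))
    (hstk' : ∀ b, stk (final b) = Function.update (fun _ => []) k₁ ((eb b).map e₁.symm))
    (h : ∀ a, Exec c (start a) (final (f a)) (time.eval (ea a).length)) :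
    Nonempty (Turing.TM2ComputableInPolyTime ea eb f) := by
  -- The extra step is the halting statement at the label `none`.
  refine ⟨⟨⟨machine c k₀ k₁ init, e₀, e₁⟩, time + 1, fun a => ?_⟩⟩
  have hr := (h a).reachesIn (mach := (machine c k₀ k₁ init).m) (emb := some) (next := none)
    fun l => rfl
  have hr' : ReachesIn (machine c k₀ k₁ init).m (cfg var stk (some c.entry) (start a))
      ⟨none, var (final (f a)), stk (final (f a))⟩ (time.eval (ea a).length + 1) :=
    hr.trans (ReachesIn.single rfl)
  have hinit : Turing.initList (machine c k₀ k₁ init) ((ea a).map e₀.symm) =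
      cfg (Λ := Option c.Label) var stk (some c.entry) (start a) := by
    unfold Turing.initList cfg
    congr 1
    · exact (hvar a).symm
    · rw [hstk]
      exact dite_eq_update k₀ _
  have hhalt : Turing.haltList (machine c k₀ k₁ init) ((eb (f a)).map e₁.symm) =
      ⟨none, var (final (f a)), stk (final (f a))⟩ := by
    unfold Turing.haltList
    congr 1
    · exact (hvar' _).symm
    · rw [hstk']
      exact dite_eq_update k₁ _
  have hs : ∃ s ≤ time.eval (ea a).length + 1,
      (flip bind (machine c k₀ k₁ init).step)^[s]
        (some (Turing.initList (machine c k₀ k₁ init) ((ea a).map e₀.symm))) =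
      some (Turing.haltList (machine c k₀ k₁ init) ((eb (f a)).map e₁.symm)) := by
    rw [hinit, hhalt]
    exact hr'
  exact
    { steps := hs.choose
      evals_in_steps := hs.choose_spec.2
      steps_le_m := by simpa using hs.choose_spec.1 }

end StackProgram

/-! ### The deciding program and its memory -/

namespace PawnGames
namespace Decider

open StackProgram

/-- The parts of the description of a vertex. -/
inductive Mode
  | tok | tgt | own | adj
  deriving DecidableEq

instance : Fintype Mode := ⟨{.tok, .tgt, .own, .adj}, fun x => by cases x <;> simp⟩

/-- What the machine knows about a vertex: whether the token starts on it, whether it is a target,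
whether Player 1 controls it initially, and whether he is known to win when the token is on it and
he (`w₁`) or his opponent (`w₂`) controls it. -/
structure VertexRecord where
  tok : Bool
  tgt : Bool
  ctl : Bool
  w₁ : Bool
  w₂ : Bool
  deriving Fintype, Inhabited

/-- The internal state. -/
structure Var where
  mode : Mode := .tok
  ok : Bool := false
  sym : Option (Option Bool) := none
  col : Option (Bool × Bool) := none
  entry : Option VertexRecord := none
  tok : Bool := false
  tgt : Bool := false
  seen : Bool := false
  ctl : Bool := false
  tokSeen : Bool := false
  some₁ : Bool := false
  some₂ : Bool := false
  all₂ : Bool := true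
  ans : Bool := false
  go : Bool := false

instance : Finite Var := by
  let f : Var → (Mode × Bool × Option (Option Bool)) × (Option (Bool × Bool) × Option VertexRecord) ×
      (Bool × Bool × Bool × Bool × Bool) × (Bool × Bool × Bool × Bool × Bool) := fun v =>
    ((v.mode, v.ok, v.sym), (v.col, v.entry), (v.tok, v.tgt, v.seen, v.ctl, v.tokSeen),
      (v.some₁, v.some₂, v.all₂, v.ans, v.go))
  refine Finite.of_injective f ?_
  rintro ⟨⟩ ⟨⟩ h
  simp only [f, Prod.mk.injEq] at h
  simp only [Var.mk.injEq]
  tauto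

noncomputable instance : Fintype Var := Fintype.ofFinite Var

/-- The stacks. -/
inductive Stack
  | input | output | cols | cols' | count | adj | adj' | recs | recs' | fresh | queue | rounds
  deriving DecidableEq

instance : Fintype Stack :=
  ⟨{.input, .output, .cols, .cols', .count, .adj, .adj', .recs, .recs', .fresh, .queue, .rounds},
    fun x => by cases x <;> simp⟩

/-- The stack alphabets. -/
@[reducible]
def Γ : Stack → Type
  | .input => Option Bool
  | .output => Bool
  | .cols => Bool × Bool
  | .cols' => Bool × Bool
  | .count => Unit
  | .adj => Option Bool
  | .adj' => Option Bool
  | .recs => VertexRecord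
  | .recs' => VertexRecord
  | .fresh => VertexRecord
  | .queue => VertexRecord
  | .rounds => Unit

/-- The memory: the internal state and the contents of the stacks. -/
structure Mem where
  var : Var := {}
  input : List (Option Bool) := []
  output : List Bool := []
  /-- For each pawn, whether Player 1 controls it initially, and whether it owns a vertex that has
  already been read. -/
  cols : List (Bool × Bool) := []
  cols' : List (Bool × Bool) := []
  count : List Unit := []
  adj : List (Option Bool) := []
  adj' : List (Option Bool) := []
  recs : List VertexRecord := []
  recs' : List VertexRecord := []
  fresh : List VertexRecord := []
  queue : List VertexRecord := []
  rounds : List Unit := []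

namespace Mem

/-- The contents of a stack. -/
@[reducible]
def stk (m : Mem) : ∀ k, List (Γ k)
  | .input => m.input
  | .output => m.output
  | .cols => m.cols
  | .cols' => m.cols'
  | .count => m.count
  | .adj => m.adj
  | .adj' => m.adj'
  | .recs => m.recs
  | .recs' => m.recs'
  | .fresh => m.fresh
  | .queue => m.queue
  | .rounds => m.rounds

/-- Replace the contents of a stack. -/
@[reducible]
def set (m : Mem) : ∀ k, List (Γ k) → Mem
  | .input, x => { m with input := x }
  | .output, x => { m with output := x }
  | .cols, x => { m with cols := x }
  | .cols', x => { m with cols' := x }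
  | .count, x => { m with count := x }
  | .adj, x => { m with adj := x }
  | .adj', x => { m with adj' := x }
  | .recs, x => { m with recs := x }
  | .recs', x => { m with recs' := x }
  | .fresh, x => { m with fresh := x }
  | .queue, x => { m with queue := x }
  | .rounds, x => { m with rounds := x }

/-- Replace the internal state. -/
@[reducible]
def setVar (m : Mem) (v : Var) : Mem := { m with var := v }

theorem stk_set (m : Mem) (k : Stack) (x : List (Γ k)) :
    (m.set k x).stk = Function.update m.stk k x := by
  funext k'
  cases k <;> cases k' <;> simp

theorem var_set (m : Mem) (k : Stack) (x : List (Γ k)) : (m.set k x).var = m.var := by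
  cases k <;> rfl

theorem stk_setVar (m : Mem) (v : Var) : (m.setVar v).stk = m.stk := by
  funext k
  cases k <;> rfl

end Mem

/-- Blocks and programs on the memory. -/
abbrev Blk := Block Mem.var Mem.stk
abbrev Prog := Cmd Mem.var Mem.stk

/-- Push a symbol. -/
@[reducible]
def push (k : Stack) (f : Var → Γ k) : Blk where
  code q := .push k f q
  run m := m.set k (f m.var :: m.stk k)
  sound q m := by rw [Turing.TM2.stepAux, Mem.stk_set, Mem.var_set]

/-- Pop a symbol. -/
@[reducible]
def pop (k : Stack) (f : Var → Option (Γ k) → Var) : Blk where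
  code q := .pop k f q
  run m := (m.set k (m.stk k).tail).setVar (f m.var (m.stk k).head?)
  sound q m := by rw [Turing.TM2.stepAux, Mem.stk_setVar, Mem.stk_set]

/-- Change the internal state. -/
@[reducible]
def load (f : Var → Var) : Blk where
  code q := .load f q
  run m := m.setVar (f m.var)
  sound q m := by rw [Turing.TM2.stepAux, Mem.stk_setVar]

/-- Run one block after the other. -/
infixr:60 " ⨾ " => Block.comp

/-- Run one program after the other. -/
infixr:55 " ⨾⨾ " => Cmd.seq

/-- The bit that was read last. -/
def Var.bit (v : Var) : Bool := v.sym == some (some true)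

/-- Whether the symbol that was read last is a bit. -/
def Var.isBit (v : Var) : Bool := v.sym.any Option.isSome

/-- Reject the input. -/
def fail : Blk := load fun v => { v with ok := false }

/-- Store the pawns that Player 1 controls initially in `cols'`, and their number in `count`. -/
def readPawns : Prog :=
  .loop (pop .input fun v x => { v with sym := x }) Var.isBit
    (.block (push .cols' (fun v => (v.bit, false)) ⨾ push .count (fun _ => ())))

/-- Move `cols'` to `cols`, and check that the first separator has been found. -/
def initCols : Prog :=
  .block (load fun v => { v with ok := v.sym == some none, sym := none }) ⨾⨾
  .loop (pop .cols' fun v x => { v with col := x }) (fun v => v.col.isSome)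
    (.block (push .cols fun v => v.col.getD default))

/-- Read the mark of the initial vertex. -/
def readTok : Blk :=
  .branch Var.isBit
    (load fun v =>
      -- Overwriting `ok` loses nothing, since `readSymbol` comes here only while `ok` holds.
      { v with tok := v.bit, ok := !(v.bit && v.tokSeen), tokSeen := v.tokSeen || v.bit,
               mode := .tgt, sym := none })
    fail

/-- Read the mark of the target vertices. -/
def readTgt : Blk :=
  .branch Var.isBit (load fun v => { v with tgt := v.bit, mode := .own, sym := none }) fail

/-- Read whether the next pawn owns the current vertex. -/
def readOwn : Blk :=
  pop .cols (fun v x => { v with col := x }) ⨾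
  .branch Var.isBit
    (.branch (fun v => v.col.isSome)
      (push .cols' (fun v => ((v.col.getD default).1, (v.col.getD default).2 || v.bit)) ⨾
        load fun v =>
          { v with ok := !(v.bit && ((v.col.getD default).2 || v.seen)), seen := v.seen || v.bit,
                   ctl := v.ctl || (v.bit && (v.col.getD default).1), col := none, sym := none })
      fail)
    -- The separator is pushed before the row because the stack reverses the order: read from the
    -- top, it ends the row.
    (push .adj (fun _ => none) ⨾
      load fun v =>
        { v with ok := v.col.isNone && v.seen, seen := false, mode := .adj, col := none,
                 sym := none })

/-- Read whether the next vertex is a neighbor of the current vertex. -/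
def readAdj : Blk :=
  pop .cols' (fun v x => { v with col := x }) ⨾
  .branch Var.isBit
    (.branch (fun v => v.col.isSome)
      (push .cols (fun v => v.col.getD default) ⨾ push .adj (fun v => some v.bit) ⨾
        load fun v => { v with col := none, sym := none })
      fail)
    -- One unit of `count` is consumed per vertex, so `count` runs out exactly at the last row iff
    -- there are as many vertices as pawns.
    (pop .count (fun v x => { v with ok := v.col.isNone && x.isSome }) ⨾
      push .recs (fun v => ⟨v.tok, v.tgt, v.ctl, false, false⟩) ⨾
      push .queue (fun v => ⟨v.tok, v.tgt, v.ctl, false, false⟩) ⨾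
      -- Two units per vertex amount to the `2 * n` rounds after which `FrozenWin` is stationary.
      push .rounds (fun _ => ()) ⨾ push .rounds (fun _ => ()) ⨾
      load fun v => { v with mode := .tok, tok := false, tgt := false, ctl := false,
                             col := none, sym := none })

/-- Process the symbol that was read last. -/
def readSymbol : Blk :=
  .branch (fun v => v.ok)
    (.branch (fun v => v.mode = .tok) readTok
      (.branch (fun v => v.mode = .tgt) readTgt
        (.branch (fun v => v.mode = .own) readOwn readAdj)))
    fail

/-- Read the descriptions of the vertices. -/
def readVertices : Prog :=
  .loop (pop .input fun v x => { v with sym := x }) (fun v => v.sym.isSome) (.block readSymbol)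

/-- Check that the input did not end prematurely. -/
def check : Prog :=
  .block (pop .count fun v x =>
    { v with ok := v.ok && decide (v.mode = .tok) && v.tokSeen && x.isNone })

/-- Player 1 wins after he has moved the token to the vertex of the record. -/
def VertexRecord.enter₁ (r : VertexRecord) : Bool := r.w₂ && (!r.ctl || r.w₁)

/-- Player 1 wins after Player 2 has moved the token to the vertex of the record. -/
def VertexRecord.enter₂ (r : VertexRecord) : Bool := r.w₁ || (!r.ctl && r.w₂)

/-- Look at the next entry of a row of the adjacency matrix. -/
def scanEntry : Blk :=
  pop .recs (fun v x => { v with entry := x }) ⨾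
  push .recs' (fun v => v.entry.getD default) ⨾
  push .adj' (fun v => some v.bit) ⨾
  load fun v =>
    { v with some₁ := v.some₁ || (v.bit && (v.entry.getD default).enter₁),
             some₂ := v.some₂ || v.bit,
             all₂ := v.all₂ && (!v.bit || (v.entry.getD default).enter₂),
             sym := none, entry := none }

/-- Compute the new record of a vertex at the end of its row. -/
def finishRow : Blk :=
  push .adj' (fun _ => none) ⨾
  pop .queue (fun v x => { v with entry := x }) ⨾
  push .fresh (fun v =>
    { v.entry.getD default with
      w₁ := (v.entry.getD default).tgt || v.some₁,
      w₂ := (v.entry.getD default).tgt || (v.some₂ && v.all₂) }) ⨾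
  load fun v => { v with some₁ := false, some₂ := false, all₂ := true, sym := none, entry := none }

/-- Move `recs'` to `recs`. -/
def restoreRecs : Prog :=
  .loop (pop .recs' fun v x => { v with entry := x }) (fun v => v.entry.isSome)
    (.block (push .recs (fun v => v.entry.getD default)))

/-- Go through the adjacency matrix. -/
def scanMatrix : Prog :=
  .loop (pop .adj fun v x => { v with sym := x }) (fun v => v.sym.isSome)
    (.ite Var.isBit (.block scanEntry) (.block finishRow ⨾⨾ restoreRecs))

/-- Move `adj'` to `adj`. -/
def restoreAdj : Prog :=
  .loop (pop .adj' fun v x => { v with sym := x }) (fun v => v.sym.isSome)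
    (.block (push .adj fun v => v.sym.getD default))

/-- Clear `recs`. -/
def clearRecs : Prog :=
  .loop (pop .recs fun v x => { v with entry := x }) (fun v => v.entry.isSome) (.block (load id))

/-- Move `fresh` to `recs` and `queue`. -/
def distribute : Prog :=
  .loop (pop .fresh fun v x => { v with entry := x }) (fun v => v.entry.isSome)
    (.block (push .recs (fun v => v.entry.getD default) ⨾ push .queue (fun v => v.entry.getD default)))

/-- Improve the knowledge about all vertices once. -/
def round : Prog := scanMatrix ⨾⨾ restoreAdj ⨾⨾ clearRecs ⨾⨾ distribute

/-- Improve the knowledge about all vertices until there is nothing to improve. -/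
def iterate : Prog := .loop (pop .rounds fun v x => { v with go := x.isSome }) (fun v => v.go) round

/-- Look up the answer in the record of the initial vertex. -/
def lookup : Prog :=
  .loop (pop .recs fun v x => { v with entry := x }) (fun v => v.entry.isSome)
    (.block (load fun v =>
      { v with ans := v.ans || ((v.entry.getD default).tok &&
        (if (v.entry.getD default).ctl then (v.entry.getD default).w₁ else (v.entry.getD default).w₂)) }))

/-- Pop a symbol and keep track of whether some stack was not empty. -/
@[reducible]
def drain (k : Stack) : Blk := pop k fun v x => { v with go := v.go || x.isSome }

/-- Clear all stacks. -/
def cleanup : Prog :=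
  -- A halting configuration in the sense of `Turing.haltList` has no content outside the output
  -- stack.
  .loop (load (fun v => { v with go := false }) ⨾ drain .input ⨾ drain .output ⨾ drain .cols ⨾
      drain .cols' ⨾ drain .count ⨾ drain .adj ⨾ drain .adj' ⨾ drain .recs ⨾ drain .recs' ⨾
      drain .fresh ⨾ drain .queue ⨾ drain .rounds)
    (fun v => v.go) (.block (load id))

/-- Write the answer and reset the internal state. -/
def answer : Prog := .block (push .output (fun v => v.ans) ⨾ load fun _ => {})

/-- The program that decides optional-grabbing pawn games with one vertex per pawn. -/
def program : Prog :=
  readPawns ⨾⨾ initCols ⨾⨾ readVertices ⨾⨾ check ⨾⨾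
  .ite (fun v => v.ok) (iterate ⨾⨾ lookup) (.block (load id)) ⨾⨾ cleanup ⨾⨾ answer

/-! ### Growth of the stacks -/

/-- All stacks have at most `N` symbols. -/
def Bounded (m : Mem) (N : ℕ) : Prop := ∀ k, (m.stk k).length ≤ N

/-- The block adds at most `c` symbols to each stack. -/
def Grows (b : Blk) (c : ℕ) : Prop := ∀ m N, Bounded m N → Bounded (b.run m) (N + c)

namespace Grows

theorem mono {b : Blk} {c c' : ℕ} (h : Grows b c) (hc : c ≤ c') : Grows b c' :=
  fun m N hm k => (h m N hm k).trans (by omega)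

theorem push (k : Stack) (f : Var → Γ k) : Grows (push k f) 1 := by
  intro m N hm k'
  change ((m.set k (f m.var :: m.stk k)).stk k').length ≤ N + 1
  rw [Mem.stk_set]
  by_cases hk : k' = k
  · subst hk
    simpa using hm k'
  · rw [Function.update_of_ne hk]
    exact (hm k').trans N.le_succ

theorem load (f : Var → Var) : Grows (load f) 0 := by
  intro m N hm k
  change ((m.setVar (f m.var)).stk k).length ≤ N
  rw [Mem.stk_setVar]
  exact hm k

theorem pop (k : Stack) (f : Var → Option (Γ k) → Var) : Grows (pop k f) 0 := by
  intro m N hm k'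
  change (((m.set k (m.stk k).tail).setVar (f m.var (m.stk k).head?)).stk k').length ≤ N
  rw [Mem.stk_setVar, Mem.stk_set]
  by_cases hk : k' = k
  · subst hk
    have := hm k'
    rw [Function.update_self, List.length_tail]
    omega
  · rw [Function.update_of_ne hk]
    exact hm k'

theorem comp {a b : Blk} {c c' : ℕ} (ha : Grows a c) (hb : Grows b c') :
    Grows (a ⨾ b) (c + c') := by
  intro m N hm
  rw [← add_assoc]
  exact hb _ _ (ha _ _ hm)

theorem branch {p : Var → Bool} {a b : Blk} {c c' : ℕ} (ha : Grows a c) (hb : Grows b c') :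
    Grows (.branch p a b) (max c c') := by
  intro m N hm
  simp only [Block.branch]
  split_ifs
  · exact ha.mono (le_max_left _ _) _ _ hm
  · exact hb.mono (le_max_right _ _) _ _ hm

/-- Each push is charged to every stack, so the constant is generous. It serves to bound `cleanup`
on rejected strings, where the shape of the memory is unknown. -/
theorem readSymbol : Grows readSymbol 5 := by
  refine mono (branch (branch (branch (load _) (load _)) (branch (branch (load _) (load _))
    (branch (comp (pop _ _) (branch (branch (comp (push _ _) (load _)) (load _))
      (comp (push _ _) (load _)))) (comp (pop _ _) (branch (branch (comp (push _ _)
        (comp (push _ _) (load _))) (load _)) (comp (pop _ _) (comp (push _ _) (comp (push _ _)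
          (comp (push _ _) (comp (push _ _) (load _))))))))))) (load _)) ?_
  decide

end Grows

/-! ### Execution of the reading phase -/

theorem exec_readPawns (A : List Bool) (R : List (Option Bool)) (m : Mem) :
    Exec readPawns { m with input := A.map some ++ none :: R }
      { m with
        input := R
        cols' := (A.map fun b => (b, false)).reverse ++ m.cols'
        count := (A.map fun _ => ()).reverse ++ m.count
        var := { m.var with sym := some none } } (2 * A.length + 1) := by
  induction A generalizing m with
  | nil => exact .loopDone rfl rfl
  | cons b A ih =>
    refine .mono ?_ (.loopStep rfl rfl (.block rfl) (t' := 2 * A.length + 1) ?_)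
    · simp only [List.length_cons]
      omega
    · simp only [List.map_cons, List.reverse_cons, List.append_assoc, List.singleton_append]
      cases b
      · exact ih { m with
          cols' := (false, false) :: m.cols'
          count := () :: m.count
          var := { m.var with sym := some (some false) } }
      · exact ih { m with
          cols' := (true, false) :: m.cols'
          count := () :: m.count
          var := { m.var with sym := some (some true) } }

/-- The case of a string without separator, which is no encoding but has to be rejected in
polynomial time as well. -/
theorem exec_readPawns_of_eq_map (A : List Bool) (m : Mem) :
    Exec readPawns { m with input := A.map some }
      { m with
        input := []
        cols' := (A.map fun b => (b, false)).reverse ++ m.cols'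
        count := (A.map fun _ => ()).reverse ++ m.count
        var := { m.var with sym := none } } (2 * A.length + 1) := by
  induction A generalizing m with
  | nil => exact .loopDone rfl rfl
  | cons b A ih =>
    refine .mono ?_ (.loopStep rfl rfl (.block rfl) (t' := 2 * A.length + 1) ?_)
    · simp only [List.length_cons]
      omega
    · simp only [List.map_cons, List.reverse_cons, List.append_assoc, List.singleton_append]
      cases b
      · exact ih { m with
          cols' := (false, false) :: m.cols'
          count := () :: m.count
          var := { m.var with sym := some (some false) } }
      · exact ih { m with
          cols' := (true, false) :: m.cols'
          count := () :: m.count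
          var := { m.var with sym := some (some true) } }

theorem exec_initCols (l : List (Bool × Bool)) (m : Mem) :
    Exec initCols { m with cols' := l }
      { m with
        cols' := []
        cols := l.reverse ++ m.cols
        var := { m.var with ok := m.var.sym == some none, sym := none, col := none } }
      (2 * l.length + 2) := by
  rw [show 2 * l.length + 2 = 1 + (2 * l.length + 1) by ring]
  refine .seq (.block rfl) ?_
  have key : ∀ (l : List (Bool × Bool)) (m : Mem),
      Exec (.loop (pop .cols' fun v x => { v with col := x }) (fun v => v.col.isSome)
        (.block (push .cols fun v => v.col.getD default))) { m with cols' := l }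
      { m with cols' := [], cols := l.reverse ++ m.cols, var := { m.var with col := none } }
      (2 * l.length + 1) := by
    intro l
    induction l with
    | nil => exact fun m => .loopDone rfl rfl
    | cons c l ih =>
      intro m
      refine .mono ?_ (.loopStep rfl rfl (.block rfl) (t' := 2 * l.length + 1) ?_)
      · simp only [List.length_cons]
        omega
      · simp only [List.reverse_cons, List.append_assoc, List.singleton_append]
        exact ih { m with cols := c :: m.cols, var := { m.var with col := some c } }
  exact key l { m with var := { m.var with ok := m.var.sym == some none, sym := none } }

/-- The effect of `readVertices`. -/
def readAll : List (Option Bool) → Mem → Mem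
  | [], m => { m with var := { m.var with sym := none } }
  | x :: w, m => readAll w (readSymbol.run { m with var := { m.var with sym := some x } })

/-- No branch of `readSymbol` uses the input stack, so `readAll` can recurse on the word separately
from the memory. -/
theorem readSymbol_run_input (m : Mem) (w : List (Option Bool)) :
    readSymbol.run { m with input := w } = { readSymbol.run m with input := w } := by
  obtain ⟨⟨mode, ok, sym, _, _, _, _, _, _, _, _, _, _, _, _⟩, _, _, cols, cols', _, _, _, _, _, _,
    _, _⟩ := m
  cases ok
  · rfl
  · cases mode <;> rcases sym with _ | _ | b <;> (try rfl) <;>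
      first
      | (cases cols <;> rfl)
      | (cases cols' <;> rfl)

theorem exec_readVertices (w : List (Option Bool)) (m : Mem) :
    Exec readVertices { m with input := w } { readAll w m with input := [] }
      (2 * w.length + 1) := by
  induction w generalizing m with
  | nil => exact .loopDone rfl rfl
  | cons x w ih =>
    refine .mono ?_ (.loopStep rfl rfl (.block (readSymbol_run_input
      { m with var := { m.var with sym := some x } } w)) (t' := 2 * w.length + 1) (ih _))
    simp only [List.length_cons]
    omega

theorem bounded_readAll (w : List (Option Bool)) {m : Mem} {N : ℕ} (h : Bounded m N) :
    Bounded (readAll w m) (N + 5 * w.length) := by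
  induction w generalizing m N with
  | nil => exact h
  | cons x w ih =>
    have := ih (Grows.readSymbol _ _ (show Bounded { m with var := { m.var with sym := some x } } N
      from h))
    refine fun k => (this k).trans ?_
    simp only [List.length_cons]
    omega

/-! ### The strings that pass the checks -/

/-- The input has been read completely and is not to be rejected. -/
def Accepts (m : Mem) : Prop :=
  m.var.ok = true ∧ m.var.mode = .tok ∧ m.var.tokSeen = true ∧ m.count = []

/-- Failure is permanent: without `ok`, every symbol is processed by `fail`. -/
theorem not_accepts_readAll (w : List (Option Bool)) {m : Mem} (h : m.var.ok = false) :
    ¬ Accepts (readAll w m) := by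
  induction w generalizing m with
  | nil => exact fun h' => by simp [Accepts, readAll, h] at h'
  | cons x w ih =>
    apply ih
    obtain ⟨⟨mode, ok, sym, _, _, _, _, _, _, _, _, _, _, _, _⟩, _, _, cols, cols', _, _, _, _, _, _,
      _, _⟩ := m
    obtain rfl : ok = false := h
    rfl

/-- The description of a vertex. -/
structure Row where
  tok : Bool
  tgt : Bool
  own : List Bool
  adj : List Bool

/-- The string that describes a vertex. -/
def Row.encode (r : Row) : List (Option Bool) :=
  some r.tok :: some r.tgt :: (r.own.map some ++ none :: (r.adj.map some ++ [none]))

/-- One pawn owns the current vertex, and it owns no vertex that has already been read. The pawn has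
already been found iff `s`. -/
def ValidOwn : Bool → List (Bool × Bool) → List Bool → Prop
  | s, c :: cs, b :: bs => (b && (c.2 || s)) = false ∧ ValidOwn (s || b) cs bs
  | s, _, _ => s = true

/-- The pawns that own a vertex after a row has been read. -/
def mark (cs : List (Bool × Bool)) (bs : List Bool) : List (Bool × Bool) :=
  List.zipWith (fun c b => (c.1, c.2 || b)) cs bs

/-- Player 1 controls a pawn that owns the current vertex initially. -/
def controlled (cs : List (Bool × Bool)) (bs : List Bool) : Bool :=
  (List.zipWith (fun c b => b && c.1) cs bs).any id

/-- The parameter `Q` serves two purposes: with acceptance alone the parsing lemmas show that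
encodings pass, and with equality to the final memory added they reveal that memory. Every deviation
from the expected format clears `ok` or ends the input in the wrong mode, which `Q` excludes. -/
theorem readAll_own_iff {Q : Mem → Prop} (hQ : ∀ x, Q x → Accepts x) (cs : List (Bool × Bool)) (m : Mem) (ts t g s q : Bool)
    (ds : List (Bool × Bool)) (w : List (Option Bool)) :
    Q (readAll w { m with
      var := { mode := .own, ok := true, tokSeen := ts, tok := t, tgt := g, seen := s, ctl := q }
      cols := cs
      cols' := ds }) ↔
    ∃ (bs : List Bool) (R : List (Option Bool)), w = bs.map some ++ none :: R ∧ bs.length = cs.length ∧ ValidOwn s cs bs ∧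
      Q (readAll R { m with
        var := { mode := .adj, ok := true, tokSeen := ts, tok := t, tgt := g,
                 ctl := q || controlled cs bs }
        cols := []
        cols' := (mark cs bs).reverse ++ ds
        adj := none :: m.adj }) := by
  induction cs generalizing s q ds w with
  | nil =>
    rcases w with _ | ⟨_ | b, w⟩
    · simp only [List.length_nil]
      constructor
      · intro h
        exact absurd (hQ _ h).2.1 (by simp [readAll])
      · rintro ⟨bs, R, h, -⟩
        simp at h
    · cases s
      · constructor
        · intro h
          exact (not_accepts_readAll w rfl (hQ _ h)).elim
        · rintro ⟨bs, R, h, h1, h2, -⟩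
          obtain rfl := List.length_eq_zero_iff.1 h1
          exact absurd h2 (by simp [ValidOwn])
      · constructor
        · intro h
          refine ⟨[], w, rfl, rfl, rfl, ?_⟩
          cases q <;> exact h
        · rintro ⟨bs, R, h, h1, h2, h3⟩
          obtain rfl := List.length_eq_zero_iff.1 h1
          simp only [List.map_nil, List.nil_append, List.cons.injEq, true_and] at h
          subst h
          cases q <;> exact h3
    · constructor
      · intro h
        exact (not_accepts_readAll w rfl (hQ _ h)).elim
      · rintro ⟨bs, R, h, h1, -⟩
        obtain rfl := List.length_eq_zero_iff.1 h1
        simp at h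
  | cons c cs ih =>
    rcases w with _ | ⟨_ | b, w⟩
    · constructor
      · intro h
        exact absurd (hQ _ h).2.1 (by simp [readAll])
      · rintro ⟨bs, R, h, -⟩
        simp at h
    · constructor
      · intro h
        exact (not_accepts_readAll w rfl (hQ _ h)).elim
      · rintro ⟨bs, R, h, h1, -⟩
        cases bs with
        | nil => simp at h1
        | cons b bs => simp at h
    · cases hc : b && (c.2 || s)
      · have hrun : readAll (some b :: w) { m with
            var := { mode := .own, ok := true, tokSeen := ts, tok := t, tgt := g, seen := s,
                     ctl := q }
            cols := c :: cs
            cols' := ds } = readAll w { m with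
            var := { mode := .own, ok := true, tokSeen := ts, tok := t, tgt := g, seen := s || b,
                     ctl := q || (b && c.1) }
            cols := cs
            cols' := (c.1, c.2 || b) :: ds } := by
          rw [readAll]
          congr 1
          revert hc
          rcases c with ⟨_ | _, _ | _⟩ <;> cases b <;> cases s <;> intro hc <;>
            first
            | rfl
            | exact absurd hc (by decide)
        rw [hrun, ih]
        constructor
        · rintro ⟨bs, R, rfl, h1, h2, h3⟩
          refine ⟨b :: bs, R, rfl, by simp [h1], ⟨hc, h2⟩, ?_⟩
          simpa [controlled, mark, Bool.or_assoc] using h3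
        · rintro ⟨bs, R, h, h1, h2, h3⟩
          cases bs with
          | nil => simp at h1
          | cons b' bs =>
            simp only [List.map_cons, List.cons_append, List.cons.injEq, Option.some.injEq] at h
            obtain ⟨rfl, h⟩ := h
            refine ⟨bs, R, h, by simpa using h1, h2.2, ?_⟩
            simpa [controlled, mark, Bool.or_assoc] using h3
      · constructor
        · intro h
          refine (not_accepts_readAll w ?_ (hQ _ h)).elim
          revert hc
          rcases c with ⟨_ | _, _ | _⟩ <;> cases b <;> cases s <;> intro hc <;>
            first
            | rfl
            | exact absurd hc (by decide)
        · rintro ⟨bs, R, h, h1, h2, -⟩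
          cases bs with
          | nil => simp at h1
          | cons b' bs =>
            simp only [List.map_cons, List.cons_append, List.cons.injEq, Option.some.injEq] at h
            obtain ⟨rfl, h⟩ := h
            exact absurd (h2.1.symm.trans hc) (by decide)

/-- The pawn columns move back from `cols'` to `cols` in their original order, and meanwhile they
measure the row. The adjacency row is thus compared with the number of pawns; that this is the
number of vertices follows from `count`. -/
theorem readAll_adj_iff {Q : Mem → Prop} (hQ : ∀ x, Q x → Accepts x) (ds : List (Bool × Bool)) (m : Mem) (ts t g q : Bool)
    (cs : List (Bool × Bool)) (a w : List (Option Bool)) :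
    Q (readAll w { m with
      var := { mode := .adj, ok := true, tokSeen := ts, tok := t, tgt := g, ctl := q }
      cols := cs
      cols' := ds
      adj := a }) ↔
    ∃ (bs : List Bool) (R : List (Option Bool)), w = bs.map some ++ none :: R ∧ bs.length = ds.length ∧ m.count ≠ [] ∧
      Q (readAll R { m with
        var := { mode := .tok, ok := true, tokSeen := ts }
        cols := ds.reverse ++ cs
        cols' := []
        adj := (bs.map some).reverse ++ a
        count := m.count.tail
        recs := ⟨t, g, q, false, false⟩ :: m.recs
        queue := ⟨t, g, q, false, false⟩ :: m.queue
        rounds := () :: () :: m.rounds }) := by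
  induction ds generalizing cs a w with
  | nil =>
    rcases w with _ | ⟨_ | b, w⟩
    · constructor
      · intro h
        exact absurd (hQ _ h).2.1 (by simp [readAll])
      · rintro ⟨bs, R, h, -⟩
        simp at h
    · constructor
      · intro h
        cases hc : m.count with
        | nil =>
          refine (not_accepts_readAll w ?_ (hQ _ h)).elim
          obtain ⟨_, _, _, _, _, count, _, _, _, _, _, _, _⟩ := m
          obtain rfl : count = [] := hc
          rfl
        | cons u count =>
          refine ⟨[], w, rfl, rfl, by simp, ?_⟩
          obtain ⟨_, _, _, _, _, count', _, _, _, _, _, _, _⟩ := m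
          obtain rfl : count' = u :: count := hc
          exact h
      · rintro ⟨bs, R, h, h1, h2, h3⟩
        obtain rfl := List.length_eq_zero_iff.1 h1
        simp only [List.map_nil, List.nil_append, List.cons.injEq, true_and] at h
        subst h
        obtain ⟨_, _, _, _, _, count, _, _, _, _, _, _, _⟩ := m
        cases count with
        | nil => exact (h2 rfl).elim
        | cons u count => exact h3
    · constructor
      · intro h
        exact (not_accepts_readAll w rfl (hQ _ h)).elim
      · rintro ⟨bs, R, h, h1, -⟩
        obtain rfl := List.length_eq_zero_iff.1 h1
        simp at h
  | cons d ds ih =>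
    rcases w with _ | ⟨_ | b, w⟩
    · constructor
      · intro h
        exact absurd (hQ _ h).2.1 (by simp [readAll])
      · rintro ⟨bs, R, h, -⟩
        simp at h
    · constructor
      · intro h
        refine (not_accepts_readAll w ?_ (hQ _ h)).elim
        obtain ⟨_, _, _, _, _, count, _, _, _, _, _, _, _⟩ := m
        cases count <;> rfl
      · rintro ⟨bs, R, h, h1, -⟩
        cases bs with
        | nil => simp at h1
        | cons b bs => simp at h
    · have hrun : readAll (some b :: w) { m with
            var := { mode := .adj, ok := true, tokSeen := ts, tok := t, tgt := g, ctl := q }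
            cols := cs
            cols' := d :: ds
            adj := a } = readAll w { m with
            var := { mode := .adj, ok := true, tokSeen := ts, tok := t, tgt := g, ctl := q }
            cols := d :: cs
            cols' := ds
            adj := some b :: a } := by
          rw [readAll]
          congr 1
          cases b <;> rfl
      rw [hrun, ih]
      constructor
      · rintro ⟨bs, R, rfl, h1, h2, h3⟩
        exact ⟨b :: bs, R, rfl, by simp [h1], h2, by simpa using h3⟩
      · rintro ⟨bs, R, h, h1, h2, h3⟩
        cases bs with
        | nil => simp at h1
        | cons b' bs =>
          simp only [List.map_cons, List.cons_append, List.cons.injEq, Option.some.injEq] at h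
          obtain ⟨rfl, h⟩ := h
          exact ⟨bs, R, h, by simpa using h1, h2, by simpa using h3⟩

theorem length_mark {cs : List (Bool × Bool)} {bs : List Bool} (h : bs.length = cs.length) :
    (mark cs bs).length = cs.length := by
  simp [mark, h]

/-- What the machine knows about a vertex before the first round. -/
def Row.record (r : Row) (cs : List (Bool × Bool)) : VertexRecord :=
  ⟨r.tok, r.tgt, controlled cs r.own, false, false⟩

theorem readAll_tok_iff {Q : Mem → Prop} (hQ : ∀ x, Q x → Accepts x) (m : Mem) (ts : Bool) (cs : List (Bool × Bool)) (w : List (Option Bool)) :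
    Q (readAll w { m with
      var := { mode := .tok, ok := true, tokSeen := ts }
      cols := cs
      cols' := [] }) ↔
    (w = [] ∧ Q { m with
      var := { mode := .tok, ok := true, tokSeen := ts }
      cols := cs
      cols' := [] }) ∨
    ∃ (r : Row) (R : List (Option Bool)), w = Row.encode r ++ R ∧ r.own.length = cs.length ∧ r.adj.length = cs.length ∧
      (r.tok && ts) = false ∧ ValidOwn false cs r.own ∧ m.count ≠ [] ∧
      Q (readAll R { m with
        var := { mode := .tok, ok := true, tokSeen := ts || r.tok }
        cols := mark cs r.own
        cols' := []
        adj := (r.adj.map some).reverse ++ none :: m.adj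
        count := m.count.tail
        recs := r.record cs :: m.recs
        queue := r.record cs :: m.queue
        rounds := () :: () :: m.rounds }) := by
  rcases w with _ | ⟨_ | t, w⟩
  · simp [readAll, Row.encode]
  · constructor
    · intro h
      exact (not_accepts_readAll w rfl (hQ _ h)).elim
    · rintro (⟨h, -⟩ | ⟨r, R, h, -⟩) <;> simp [Row.encode] at h
  cases hts : t && ts
  swap
  · constructor
    · intro h
      refine (not_accepts_readAll w ?_ (hQ _ h)).elim
      cases t <;> cases ts <;> first | rfl | exact absurd hts (by decide)
    · rintro (⟨h, -⟩ | ⟨r, R, h, -, -, h1, -⟩)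
      · simp at h
      · simp only [Row.encode, List.cons_append, List.cons.injEq, Option.some.injEq] at h
        rw [← h.1, hts] at h1
        exact absurd h1 (by decide)
  have hrun : readAll (some t :: w) { m with
      var := { mode := .tok, ok := true, tokSeen := ts }
      cols := cs
      cols' := [] } = readAll w { m with
      var := { mode := .tgt, ok := true, tokSeen := ts || t, tok := t }
      cols := cs
      cols' := [] } := by
    rw [readAll]
    congr 1
    cases t <;> cases ts <;> first | rfl | exact absurd hts (by decide)
  rw [hrun]
  rcases w with _ | ⟨_ | g, w⟩
  · constructor
    · intro h
      exact absurd (hQ _ h).2.1 (by simp [readAll])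
    · rintro (⟨h, -⟩ | ⟨r, R, h, -⟩) <;> simp [Row.encode] at h
  · constructor
    · intro h
      exact (not_accepts_readAll w rfl (hQ _ h)).elim
    · rintro (⟨h, -⟩ | ⟨r, R, h, -⟩) <;> simp [Row.encode] at h
  have hrun' : readAll (some g :: w) { m with
      var := { mode := .tgt, ok := true, tokSeen := ts || t, tok := t }
      cols := cs
      cols' := [] } = readAll w { m with
      var := { mode := .own, ok := true, tokSeen := ts || t, tok := t, tgt := g }
      cols := cs
      cols' := [] } := by
    rw [readAll]
    congr 1
    cases g <;> rfl
  rw [hrun', readAll_own_iff hQ]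
  constructor
  · rintro ⟨bs, R, rfl, h1, h2, h3⟩
    have h4 := (readAll_adj_iff hQ _ m _ _ _ _ _ _ _).1 h3
    obtain ⟨es, R', rfl, h5, h6, h7⟩ := h4
    rw [List.append_nil, List.length_reverse, length_mark h1] at h5
    refine Or.inr ⟨⟨t, g, bs, es⟩, R', by simp [Row.encode], h1, h5, hts, h2, h6, ?_⟩
    simpa [Row.record] using h7
  · rintro (⟨h, -⟩ | ⟨⟨t', g', bs, es⟩, R, h, h1, h2, -, h3, h4, h5⟩)
    · simp at h
    · simp only [Row.encode, List.cons_append, List.cons.injEq, Option.some.injEq,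
        List.append_assoc, List.nil_append] at h
      obtain ⟨rfl, rfl, rfl⟩ := h
      refine ⟨bs, es.map some ++ none :: R, rfl, h1, h3, ?_⟩
      refine (readAll_adj_iff hQ _ m _ _ _ _ _ _ _).2 ⟨es, R, rfl, ?_, h4, ?_⟩
      · rw [List.append_nil, List.length_reverse, length_mark h1]
        exact h2
      · simpa [Row.record] using h5

/-- The descriptions of the vertices are consistent with each other, with one pawn per vertex and one
vertex per pawn, if the vertices with the pawns `c ∈ cs` such that `c.2` have already been read, and
the initial vertex has already been read iff `ts`. -/
def Valid : List (Bool × Bool) → Bool → List Row → Prop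
  | _, _, [] => True
  | cs, ts, r :: rs => r.own.length = cs.length ∧ r.adj.length = cs.length ∧ (r.tok && ts) = false ∧
      ValidOwn false cs r.own ∧ Valid (mark cs r.own) (ts || r.tok) rs

/-- The content of the stack `adj` after the rows have been read. -/
def adjStack (rows : List Row) : List (Option Bool) :=
  rows.reverse.flatMap fun r => (r.adj.map some).reverse ++ [none]

/-- Marking changes only the second components, whereas initial control is read off the first ones.
All records can therefore be computed from the initial columns. -/
theorem record_mark {cs : List (Bool × Bool)} {bs : List Bool} (h : bs.length = cs.length)
    (r : Row) : r.record (mark cs bs) = r.record cs := by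
  have key : ∀ (cs : List (Bool × Bool)) (bs bs' : List Bool), bs.length = cs.length →
      controlled (mark cs bs) bs' = controlled cs bs' := by
    intro cs
    induction cs with
    | nil =>
      intro bs bs' h
      obtain rfl := List.length_eq_zero_iff.1 h
      rfl
    | cons c cs ih =>
      intro bs bs' h
      cases bs with
      | nil => simp at h
      | cons b bs =>
        cases bs' with
        | nil => rfl
        | cons b' bs' =>
          have := ih bs bs' (by simpa using h)
          simp only [controlled, mark, List.zipWith_cons_cons, List.any_cons] at this ⊢
          rw [this]
  rw [Row.record, Row.record, key _ _ _ h]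

/-- Induction on `count`, which loses one unit per row and has to be empty on acceptance. -/
theorem readAll_iff {Q : Mem → Prop} (hQ : ∀ x, Q x → Accepts x) (count : List Unit) (m : Mem)
    (ts : Bool) (cs : List (Bool × Bool)) (a : List (Option Bool)) (rs qs : List VertexRecord)
    (us : List Unit) (w : List (Option Bool)) :
    Q (readAll w { m with
      var := { mode := .tok, ok := true, tokSeen := ts }
      cols := cs
      cols' := []
      count := count
      adj := a
      recs := rs
      queue := qs
      rounds := us }) ↔
    ∃ rows : List Row, w = rows.flatMap Row.encode ∧ rows.length = count.length ∧
      Valid cs ts rows ∧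
      Q { m with
        var := { mode := .tok, ok := true, tokSeen := ts || rows.any Row.tok }
        cols := rows.foldl (fun cs r => mark cs r.own) cs
        cols' := []
        count := []
        adj := adjStack rows ++ a
        recs := (rows.map fun r => r.record cs).reverse ++ rs
        queue := (rows.map fun r => r.record cs).reverse ++ qs
        rounds := List.replicate (2 * rows.length) () ++ us } := by
  induction count generalizing ts cs a rs qs us w with
  | nil =>
    refine (readAll_tok_iff hQ { m with count := [], adj := a, recs := rs, queue := qs, rounds := us }
      ts cs w).trans ?_
    constructor
    · rintro (⟨rfl, h⟩ | ⟨r, R, -, -, -, -, -, h, -⟩)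
      · refine ⟨[], rfl, rfl, trivial, ?_⟩
        simpa [adjStack] using h
      · exact (h rfl).elim
    · rintro ⟨rows, rfl, h1, -, h2⟩
      obtain rfl := List.length_eq_zero_iff.1 h1
      refine Or.inl ⟨rfl, ?_⟩
      simpa [adjStack] using h2
  | cons u count ih =>
    refine (readAll_tok_iff hQ
      { m with count := u :: count, adj := a, recs := rs, queue := qs, rounds := us } ts cs w).trans ?_
    constructor
    · rintro (⟨rfl, h⟩ | ⟨r, R, rfl, h1, h2, h3, h4, -, h5⟩)
      · exact absurd (hQ _ h).2.2.2 (by simp)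
      · obtain ⟨rows, rfl, h6, h7, h8⟩ := (ih _ _ _ _ _ _ _).1 h5
        refine ⟨r :: rows, rfl, by simp [h6], ⟨h1, h2, h3, h4, h7⟩, ?_⟩
        refine Eq.mp (congrArg Q ?_) h8
        rw [Mem.mk.injEq]
        exact ⟨by simp [Bool.or_assoc], rfl, rfl, rfl, rfl, rfl, by simp [adjStack], rfl,
          by simp [record_mark h1], rfl, rfl, by simp [record_mark h1],
          by rw [List.length_cons, mul_add, List.replicate_add, List.append_assoc]; rfl⟩
    · rintro ⟨rows, rfl, h1, h2, h3⟩
      cases rows with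
      | nil => simp at h1
      | cons r rows =>
        refine Or.inr ⟨r, rows.flatMap Row.encode, rfl, h2.1, h2.2.1, h2.2.2.1, h2.2.2.2.1,
          by simp, ?_⟩
        refine (ih _ _ _ _ _ _ _).2 ⟨rows, rfl, by simpa using h1, h2.2.2.2.2, ?_⟩
        refine Eq.mp (congrArg Q ?_) h3
        rw [Mem.mk.injEq]
        exact ⟨by simp [Bool.or_assoc], rfl, rfl, rfl, rfl, rfl, by simp [adjStack], rfl,
          by simp [record_mark h2.1], rfl, rfl, by simp [record_mark h2.1],
          by rw [List.length_cons, mul_add, List.replicate_add, List.append_assoc]; rfl⟩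

/-! ### The sequential checks as conditions on all rows -/

/-- The flag `s` stands for an owner found further left, so it enters the count as one. -/
theorem validOwn_iff (cs : List (Bool × Bool)) (bs : List Bool) (s : Bool)
    (h : bs.length = cs.length) : ValidOwn s cs bs ↔
      (∀ i, bs.getD i false = true → (cs.getD i default).2 = false) ∧ bs.count true + s.toNat = 1 := by
  induction cs generalizing bs s with
  | nil =>
    obtain rfl := List.length_eq_zero_iff.1 h
    cases s <;> simp [ValidOwn]
  | cons c cs ih =>
    cases bs with
    | nil => simp at h
    | cons b bs =>
      have hall : (∀ i, (b :: bs).getD i false = true → ((c :: cs).getD i default).2 = false) ↔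
          (b = true → c.2 = false) ∧
            ∀ i, bs.getD i false = true → (cs.getD i default).2 = false := by
        constructor
        · exact fun h => ⟨h 0, fun i => h (i + 1)⟩
        · rintro ⟨h1, h2⟩ (_ | i)
          · exact h1
          · exact h2 i
      rw [hall, ValidOwn, ih _ _ (by simpa using h)]
      cases b <;> cases s <;> cases c.2 <;> simp

theorem getD_mark (cs : List (Bool × Bool)) (bs : List Bool) (h : bs.length = cs.length) (i : ℕ) :
    ((mark cs bs).getD i default).2 = ((cs.getD i default).2 || bs.getD i false) := by
  induction cs generalizing bs i with
  | nil =>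
    obtain rfl := List.length_eq_zero_iff.1 h
    rfl
  | cons c cs ih =>
    cases bs with
    | nil => simp at h
    | cons b bs =>
      cases i with
      | zero => rfl
      | succ i => exact ih bs (by simpa using h) i

/-- A column is marked while the rows are read iff it was marked at the start or some earlier row
owns it. Rejecting marked columns therefore splits into a condition on `cs` and disjointness of any
two rows. -/
theorem valid_iff (rows : List Row) (cs : List (Bool × Bool)) (ts : Bool) : Valid cs ts rows ↔
    (∀ r ∈ rows, r.own.length = cs.length ∧ r.adj.length = cs.length ∧ r.own.count true = 1 ∧
      ∀ i, r.own.getD i false = true → (cs.getD i default).2 = false) ∧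
    rows.Pairwise (fun r r' => ∀ i, r.own.getD i false = true → r'.own.getD i false = false) ∧
    (rows.map Row.tok).count true + ts.toNat ≤ 1 := by
  induction rows generalizing cs ts with
  | nil => simp [Valid, Bool.toNat_le]
  | cons r rows ih =>
    rw [Valid, ih, List.forall_mem_cons, List.pairwise_cons]
    constructor
    · rintro ⟨h1, h2, h3, h4, h5, h6, h7⟩
      rw [length_mark h1] at h5
      obtain ⟨h8, h9⟩ := (validOwn_iff _ _ _ h1).1 h4
      refine ⟨⟨⟨h1, h2, by simpa using h9, h8⟩, fun r' hr' => ?_⟩, ⟨fun r' hr' i hi => ?_, h6⟩, ?_⟩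
      · obtain ⟨h10, h11, h12, h13⟩ := h5 r' hr'
        refine ⟨h10, h11, h12, fun i hi => ?_⟩
        have := h13 i hi
        rw [getD_mark _ _ h1, Bool.or_eq_false_iff] at this
        exact this.1
      · by_contra hi'
        have := (h5 r' hr').2.2.2 i (by simpa using hi')
        rw [getD_mark _ _ h1, Bool.or_eq_false_iff] at this
        rw [this.2] at hi
        exact absurd hi (by decide)
      · revert h3 h7
        rw [List.map_cons]
        cases r.tok <;> cases ts <;> simp
    · rintro ⟨⟨⟨h1, h2, h3, h4⟩, h5⟩, ⟨h6, h7⟩, h8⟩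
      refine ⟨h1, h2, ?_, (validOwn_iff _ _ _ h1).2 ⟨h4, by simpa using h3⟩, fun r' hr' => ?_, h7, ?_⟩
      · revert h8
        rw [List.map_cons]
        cases r.tok <;> cases ts <;> simp
      · obtain ⟨h9, h10, h11, h12⟩ := h5 r' hr'
        rw [length_mark h1]
        refine ⟨h9, h10, h11, fun i hi => ?_⟩
        rw [getD_mark _ _ h1, h12 i hi]
        by_contra hi'
        rw [h6 r' hr' i (by simpa using hi')] at hi
        exact absurd hi (by decide)
      · revert h8
        rw [List.map_cons]
        cases r.tok <;> cases ts <;> simp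

theorem count_map_finRange {n : ℕ} (f : Fin n → Bool) :
    ((List.finRange n).map f).count true = 1 ↔ ∃! i, f i = true := by
  have h : ((List.finRange n).map f).count true = (Finset.univ.filter fun i => f i = true).card := by
    rw [List.count, List.countP_map, List.countP_eq_length_filter, Finset.card_def,
      Finset.filter_val, Fin.univ_def]
    simp [Function.comp_def]
  rw [h, Finset.card_eq_one]
  constructor
  · rintro ⟨a, ha⟩
    simp only [Finset.ext_iff, Finset.mem_filter, Finset.mem_univ, true_and,
      Finset.mem_singleton] at ha
    exact ⟨a, (ha a).2 rfl, fun b hb => (ha b).1 hb⟩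
  · rintro ⟨a, ha, ha'⟩
    refine ⟨a, ?_⟩
    ext b
    simp only [Finset.mem_filter, Finset.mem_univ, true_and, Finset.mem_singleton]
    exact ⟨ha' b, fun h => h ▸ ha⟩

theorem exists_eq_map_finRange {α : Type} {n : ℕ} (l : List α) (h : l.length = n) :
    ∃ f : Fin n → α, l = (List.finRange n).map f := by
  subst h
  exact ⟨l.get, by simp⟩

theorem getD_map_finRange {n : ℕ} (f : Fin n → Bool) (i : ℕ) :
    ((List.finRange n).map f).getD i false = true ↔ ∃ h : i < n, f ⟨i, h⟩ = true := by
  by_cases h : i < n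
  · simp [List.getD, h]
  · simp [List.getD, h]

end Decider

/-! ### Accepted strings are the encodings of OVPP inputs -/

namespace Input

open Decider

/-- The description of a vertex. -/
def row (I : Input) (v : Fin I.n) : Row where
  tok := decide (v = I.token)
  tgt := decide (v ∈ I.game.T)
  own := (List.finRange I.d).map fun j => decide (v ∈ I.game.own j)
  adj := (List.finRange I.n).map fun u => decide ((v, u) ∈ I.game.E)

/-- The pawns that Player 1 controls initially. -/
def pawnBits (I : Input) : List Bool := (List.finRange I.d).map fun j => decide (j ∈ I.pawns)

/-- The descriptions of the vertices. -/
def rows (I : Input) : List Row := (List.finRange I.n).map I.row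

theorem encode_eq (I : Input) :
    I.encode = I.pawnBits.map some ++ none :: I.rows.flatMap Row.encode := by
  have h : I.encodeVertex = fun v => (I.row v).encode := by
    funext v
    simp [encodeVertex, Row.encode, row, Function.comp_def]
  simp [encode, pawnBits, rows, List.flatMap_map, h, Function.comp_def]

/-- The conditions that the machine checks hold iff the input is a pawn game with one vertex per
pawn. -/
theorem valid_iff_isOVPP (I : Input) :
    (Valid (I.pawnBits.map fun b => (b, false)) false I.rows ∧ I.rows.length = I.pawnBits.length) ↔
      I.game.IsOVPP := by
  have hcs : ∀ i, ((I.pawnBits.map fun b => (b, false)).getD i default).2 = false := by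
    intro i
    rw [List.getD_eq_getElem?_getD, List.getElem?_map]
    cases I.pawnBits[i]? <;> rfl
  simp only [valid_iff, hcs, implies_true, and_true, List.length_map, List.forall_mem_map, rows]
  simp only [row, pawnBits, List.length_map, List.length_finRange, count_map_finRange,
    List.pairwise_map, List.map_map, Function.comp_def, Bool.toNat_false, add_zero]
  constructor
  · rintro ⟨⟨h1, h2, -⟩, hn⟩
    -- The unique owner of each vertex. Disjointness of the rows makes `f` injective, and `hn` then
    -- makes it bijective.
    choose f hf hf' using fun v => (h1 v (List.mem_finRange v)).2.2
    simp only [decide_eq_true_eq] at hf hf'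
    have hinj : Function.Injective f := by
      have key : ∀ v v', v < v' → f v ≠ f v' := by
        intro v v' hv h
        have h3 := List.pairwise_iff_getElem.1 h2 v v' (by simp) (by simp) hv (f v)
        simp only [List.getElem_finRange] at h3
        have h4 := h3 ((getD_map_finRange _ _).2 ⟨(f v).2, by simpa using hf v⟩)
        have h5 := (getD_map_finRange (fun j => decide (v' ∈ I.game.own j)) (f v)).2
          ⟨(f v).2, by simpa [h] using hf v'⟩
        have h6 := h4.symm.trans h5
        exact absurd h6 (by decide)
      intro v v' h
      rcases lt_trichotomy v v' with hv | hv | hv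
      · exact (key _ _ hv h).elim
      · exact hv
      · exact (key _ _ hv h.symm).elim
    have hbij : Function.Bijective f :=
      (Fintype.bijective_iff_injective_and_card f).2 ⟨hinj, by simp [hn]⟩
    let e := Equiv.ofBijective f hbij
    refine ⟨e.symm, fun j => ?_⟩
    ext v
    rw [Finset.mem_singleton, Equiv.eq_symm_apply]
    constructor
    · exact fun h => (hf' v j h).symm
    · rintro rfl
      exact hf v
  · rintro ⟨e, he⟩
    have hn : I.n = I.d := by simpa using (Fintype.card_congr e).symm
    have hown : ∀ v j, v ∈ I.game.own j ↔ j = e.symm v := by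
      intro v j
      rw [he, Finset.mem_singleton, Equiv.eq_symm_apply]
      exact eq_comm
    simp only [hown, decide_eq_true_eq]
    refine ⟨⟨fun v _ => ⟨trivial, hn, ⟨e.symm v, rfl, fun j hj => hj⟩⟩, ?_, ?_⟩, hn⟩
    · refine List.Pairwise.imp (R := (· < ·)) (fun {v v'} hv i hi => ?_) (List.pairwise_lt_finRange _)
      by_contra hc
      obtain ⟨hi1, h1⟩ := (getD_map_finRange _ _).1 hi
      obtain ⟨hi2, h2⟩ := (getD_map_finRange _ _).1 (by simpa using hc)
      simp only [decide_eq_true_eq] at h1 h2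
      exact hv.ne (e.symm.injective (h1.symm.trans h2))
    · refine ((count_map_finRange _).2 ⟨I.token, ?_⟩).le
      simp

/-- The conditions that the machine checks hold only for inputs. -/
theorem exists_of_valid {P : List Bool} {rows : List Row}
    (h : Valid (P.map fun b => (b, false)) false rows) (hn : rows.length = P.length)
    (ht : rows.any Row.tok = true) : ∃ I : Input, I.pawnBits = P ∧ I.rows = rows := by
  obtain ⟨h1, -, h2⟩ := (valid_iff _ _ _).1 h
  simp only [List.length_map] at h1
  obtain ⟨n, hP⟩ : ∃ n, P.length = n := ⟨_, rfl⟩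
  rw [hP] at h1 hn
  obtain ⟨p, rfl⟩ := exists_eq_map_finRange P hP
  obtain ⟨f, rfl⟩ := exists_eq_map_finRange rows hn
  simp only [List.forall_mem_map] at h1
  choose o ho using fun v => exists_eq_map_finRange _ (h1 v (List.mem_finRange v)).1
  choose a ha using fun v => exists_eq_map_finRange _ (h1 v (List.mem_finRange v)).2.1
  have hcover : ∀ v, ∃ j, o v j = true := by
    intro v
    have := (h1 v (List.mem_finRange v)).2.2.1
    rw [ho, count_map_finRange] at this
    exact this.exists
  have htok : ∃! v, (f v).tok = true := by
    rw [← count_map_finRange]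
    -- `Valid` allows at most one mark of the initial vertex, and `ht` provides one.
    refine le_antisymm (by simpa [Function.comp_def] using h2) (List.one_le_count_iff.2 ?_)
    simpa using ht
  obtain ⟨token, htoken, htoken'⟩ := htok
  refine ⟨⟨n, n, ⟨fun j => Finset.univ.filter fun v => o v j = true, fun v => ?_,
    Finset.univ.filter fun x => a x.1 x.2 = true, Finset.univ.filter fun v => (f v).tgt = true⟩,
    token, Finset.univ.filter fun j => p j = true⟩, ?_, ?_⟩
  · exact (hcover v).imp fun j hj => by simpa using hj
  · simp [pawnBits]
  · refine List.map_congr_left fun v _ => ?_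
    have h3 : decide (v = token) = (f v).tok := by
      rw [Bool.eq_iff_iff, decide_eq_true_eq]
      exact ⟨fun h => h ▸ htoken, htoken' v⟩
    have h4 := ho v
    have h5 := ha v
    revert h3 h4 h5
    generalize hr : f v = r
    obtain ⟨t, g, own, adj⟩ := r
    rintro h3 h4 h5
    simp only at h3 h4 h5
    simp [row, h3, h4, h5, hr]

end Input
-- Execution of the rounds, the lookup and the cleanup
namespace Decider

open StackProgram

theorem exec_restoreRecs (l : List VertexRecord) (m : Mem) :
    Exec restoreRecs { m with recs' := l }
      { m with recs' := [], recs := l.reverse ++ m.recs, var := { m.var with entry := none } }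
      (2 * l.length + 1) := by
  induction l generalizing m with
  | nil => exact .loopDone rfl rfl
  | cons r l ih =>
    refine .mono ?_ (.loopStep rfl rfl (.block rfl) (t' := 2 * l.length + 1) ?_)
    · simp only [List.length_cons]
      omega
    · simp only [List.reverse_cons, List.append_assoc, List.singleton_append]
      exact ih { m with recs := r :: m.recs, var := { m.var with entry := some r } }

theorem exec_restoreAdj (l : List (Option Bool)) (m : Mem) :
    Exec restoreAdj { m with adj' := l }
      { m with adj' := [], adj := l.reverse ++ m.adj, var := { m.var with sym := none } }
      (2 * l.length + 1) := by
  induction l generalizing m with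
  | nil => exact .loopDone rfl rfl
  | cons x l ih =>
    refine .mono ?_ (.loopStep rfl rfl (.block rfl) (t' := 2 * l.length + 1) ?_)
    · simp only [List.length_cons]
      omega
    · simp only [List.reverse_cons, List.append_assoc, List.singleton_append]
      exact ih { m with adj := x :: m.adj, var := { m.var with sym := some x } }

theorem exec_clearRecs (l : List VertexRecord) (m : Mem) :
    Exec clearRecs { m with recs := l } { m with recs := [], var := { m.var with entry := none } }
      (2 * l.length + 1) := by
  induction l generalizing m with
  | nil => exact .loopDone rfl rfl
  | cons r l ih =>
    refine .mono ?_ (.loopStep rfl rfl (.block rfl) (t' := 2 * l.length + 1) ?_)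
    · simp only [List.length_cons]
      omega
    · exact ih { m with var := { m.var with entry := some r } }

theorem exec_distribute (l : List VertexRecord) (m : Mem) :
    Exec distribute { m with fresh := l }
      { m with
        fresh := []
        recs := l.reverse ++ m.recs
        queue := l.reverse ++ m.queue
        var := { m.var with entry := none } } (2 * l.length + 1) := by
  induction l generalizing m with
  | nil => exact .loopDone rfl rfl
  | cons r l ih =>
    refine .mono ?_ (.loopStep rfl rfl (.block rfl) (t' := 2 * l.length + 1) ?_)
    · simp only [List.length_cons]
      omega
    · simp only [List.reverse_cons, List.append_assoc, List.singleton_append]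
      exact ih { m with
        recs := r :: m.recs
        queue := r :: m.queue
        var := { m.var with entry := some r } }

/-- The answer of a record, if it is the record of the initial vertex. -/
def VertexRecord.answer (r : VertexRecord) : Bool := r.tok && if r.ctl then r.w₁ else r.w₂

theorem exec_lookup (l : List VertexRecord) (m : Mem) :
    Exec lookup { m with recs := l }
      { m with
        recs := []
        var := { m.var with entry := none, ans := m.var.ans || l.any VertexRecord.answer } }
      (2 * l.length + 1) := by
  induction l generalizing m with
  | nil =>
    refine .loopDone ?_ rfl
    rw [List.any_nil, Bool.or_false]
    rfl
  | cons r l ih =>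
    refine .mono ?_ (.loopStep rfl rfl (.block rfl) (t' := 2 * l.length + 1) ?_)
    · simp only [List.length_cons]
      omega
    · simp only [List.any_cons, ← Bool.or_assoc]
      exact ih { m with var := { m.var with entry := some r, ans := m.var.ans || r.answer } }

section

variable {α : Type} (E : α → α → Bool) (vs : List α) (f : α → VertexRecord)

/-- The records after one more round. -/
def improve (v : α) : VertexRecord :=
  { f v with
    w₁ := (f v).tgt || vs.any fun u => E v u && (f u).enter₁
    w₂ := (f v).tgt || (vs.any (E v) && vs.all fun u => !E v u || (f u).enter₂) }

/-- The rows of the adjacency matrix, as they are stored in the stack `adj`. -/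
def matrix (ws : List α) : List (Option Bool) :=
  ws.flatMap fun v => vs.map (fun u => some (E v u)) ++ [none]

theorem length_matrix (ws : List α) : (matrix E vs ws).length = ws.length * (vs.length + 1) := by
  induction ws with
  | nil => simp [matrix]
  | cons v ws ih =>
    simp only [matrix, List.flatMap_cons, List.length_append] at ih ⊢
    simp only [ih, List.length_map, List.length_cons, List.length_nil]
    ring

/-- An internal state during `scanMatrix`. -/
@[reducible]
def scanning (v : Var) (x y z : Bool) : Var :=
  { v with sym := none, entry := none, some₁ := x, some₂ := y, all₂ := z }

/-- Stated with a continuation because a row is only a segment of the iterations of the single loop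
`scanMatrix`. Each entry costs three steps: the loop head, the case distinction and the block. -/
theorem exec_scanRow (e : α → Bool) (us : List α) (R : List (Option Bool)) (m m' : Mem) (t : ℕ)
    (x y z : Bool)
    (h : Exec scanMatrix { m with
      adj := R
      adj' := (us.map fun u => some (e u)).reverse ++ m.adj'
      recs' := (us.map f).reverse ++ m.recs'
      var := scanning m.var (x || us.any fun u => e u && (f u).enter₁) (y || us.any e)
        (z && us.all fun u => !e u || (f u).enter₂) } m' t) :
    Exec scanMatrix { m with
      adj := us.map (fun u => some (e u)) ++ R
      recs := us.map f ++ m.recs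
      var := scanning m.var x y z } m' (t + 3 * us.length) := by
  induction us generalizing m x y z with
  | nil => simpa using h
  | cons u us ih =>
    simp only [List.map_cons, List.reverse_cons, List.append_assoc, List.singleton_append,
      List.any_cons, List.all_cons, ← Bool.or_assoc, ← Bool.and_assoc] at h
    have h' := ih { m with adj' := some (e u) :: m.adj', recs' := f u :: m.recs' }
      (x || (e u && (f u).enter₁)) (y || e u) (z && (!e u || (f u).enter₂)) h
    simp only [List.map_cons, List.cons_append]
    refine .mono ?_ (.loopStep rfl rfl (.iteTrue rfl (.block ?_)) h')
    · simp only [List.length_cons]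
      omega
    · cases e u <;> rfl

/-- Per row, the scan costs `3 * vs.length`, putting the records back costs `2 * vs.length + 1`, and
three more steps treat the separator. All rows are evaluated with the old `f`, as the new records
wait in `fresh`. -/
theorem exec_scanMatrix (ws : List α) (m : Mem) :
    Exec scanMatrix { m with
        adj := matrix E vs ws
        recs := vs.map f
        recs' := []
        queue := ws.map f
        var := scanning m.var false false true }
      { m with
        adj := []
        adj' := (matrix E vs ws).reverse ++ m.adj'
        recs := vs.map f
        recs' := []
        queue := []
        fresh := (ws.map (improve E vs f)).reverse ++ m.fresh
        var := scanning m.var false false true } (ws.length * (5 * vs.length + 4) + 1) := by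
  induction ws generalizing m with
  | nil =>
    refine .mono (t := 1) (by omega) (.loopDone rfl rfl)
  | cons w ws ih =>
    have hadj : matrix E vs (w :: ws) =
        vs.map (fun u => some (E w u)) ++ none :: matrix E vs ws := by
      simp [matrix]
    rw [hadj]
    have h₁ := exec_scanRow f (E w) vs (none :: matrix E vs ws) { m with
      recs := []
      recs' := []
      queue := (w :: ws).map f }
    simp only [List.append_nil] at h₁
    refine .mono ?_ (h₁ _ (1 + (2 * vs.length + 1) + 1 + (ws.length * (5 * vs.length + 4) + 1) + 1)
      false false true ?_)
    · simp only [List.length_cons]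
      linarith
    clear h₁
    have h₂ := exec_restoreRecs ((vs.map f).reverse) { m with
      adj := matrix E vs ws
      adj' := none :: (vs.map fun u => some (E w u)).reverse ++ m.adj'
      recs := []
      queue := ws.map f
      fresh := improve E vs f w :: m.fresh
      var := scanning m.var false false true }
    simp only [List.length_reverse, List.length_map, List.reverse_reverse, List.append_nil] at h₂
    have h₃ := ih { m with
      adj' := none :: (vs.map fun u => some (E w u)).reverse ++ m.adj'
      fresh := improve E vs f w :: m.fresh }
    refine .loopStep rfl rfl (.iteFalse rfl (.seq (.block ?_) h₂)) ?_
    · simp only [Bool.false_or, Bool.true_and]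
      rfl
    · simp only [List.map_cons, List.reverse_cons, List.reverse_append, List.append_assoc,
        List.cons_append, List.nil_append] at h₃ ⊢
      exact h₃

theorem exec_round (m : Mem) :
    Exec round { m with
        adj := matrix E vs vs
        adj' := []
        recs := vs.map f
        recs' := []
        fresh := []
        queue := vs.map f
        var := scanning m.var false false true }
      { m with
        adj := matrix E vs vs
        adj' := []
        recs := vs.map (improve E vs f)
        recs' := []
        fresh := []
        queue := vs.map (improve E vs f)
        var := scanning m.var false false true }
      (7 * vs.length ^ 2 + 10 * vs.length + 4) := by
  have h₁ := exec_scanMatrix E vs f vs { m with adj' := [], fresh := [] }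
  have h₂ := exec_restoreAdj (matrix E vs vs).reverse { m with
    adj := []
    recs := vs.map f
    recs' := []
    queue := []
    fresh := (vs.map (improve E vs f)).reverse
    var := scanning m.var false false true }
  have h₃ := exec_clearRecs (vs.map f) { m with
    adj := matrix E vs vs
    adj' := []
    recs' := []
    queue := []
    fresh := (vs.map (improve E vs f)).reverse
    var := scanning m.var false false true }
  have h₄ := exec_distribute (vs.map (improve E vs f)).reverse { m with
    adj := matrix E vs vs
    adj' := []
    recs := []
    recs' := []
    queue := []
    var := scanning m.var false false true }
  simp only [List.append_nil, List.reverse_reverse, List.length_reverse, List.length_map,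
    length_matrix] at h₁ h₂ h₃ h₄
  refine .mono ?_ (.seq h₁ (.seq h₂ (.seq h₃ h₄)))
  nlinarith

theorem exec_iterate (k : ℕ) (m : Mem) :
    Exec iterate { m with
        adj := matrix E vs vs
        adj' := []
        recs := vs.map f
        recs' := []
        fresh := []
        queue := vs.map f
        rounds := List.replicate k ()
        var := scanning m.var false false true }
      { m with
        adj := matrix E vs vs
        adj' := []
        recs := vs.map ((improve E vs)^[k] f)
        recs' := []
        fresh := []
        queue := vs.map ((improve E vs)^[k] f)
        rounds := []
        var := { scanning m.var false false true with go := false } }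
      (k * (7 * vs.length ^ 2 + 10 * vs.length + 5) + 1) := by
  induction k generalizing f m with
  | zero => exact .mono (by omega) (.loopDone rfl rfl)
  | succ k ih =>
    rw [List.replicate_succ]
    have h := exec_round E vs f { m with
      rounds := List.replicate k ()
      var := { m.var with go := true } }
    refine .mono ?_ (.loopStep rfl rfl h (ih (improve E vs f) { m with
      var := { m.var with go := true } }))
    linarith

end

theorem exec_skip (m : Mem) : Exec (.block (load id) : Prog) m m 1 := .block rfl

/-- Each pass shortens all nonempty stacks at once, so the longest stack determines the time; the
final pass only detects that everything is empty. -/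
theorem exec_cleanup (N : ℕ) (m : Mem) (h : Bounded m N) :
    Exec cleanup m { var := { m.var with go := false } } (2 * N + 1) := by
  induction N generalizing m with
  | zero =>
    obtain ⟨v, l₁, l₂, l₃, l₄, l₅, l₆, l₇, l₈, l₉, l₁₀, l₁₁, l₁₂⟩ := m
    obtain rfl := List.eq_nil_of_length_eq_zero (Nat.le_zero.1 (h .input))
    obtain rfl := List.eq_nil_of_length_eq_zero (Nat.le_zero.1 (h .output))
    obtain rfl := List.eq_nil_of_length_eq_zero (Nat.le_zero.1 (h .cols))
    obtain rfl := List.eq_nil_of_length_eq_zero (Nat.le_zero.1 (h .cols'))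
    obtain rfl := List.eq_nil_of_length_eq_zero (Nat.le_zero.1 (h .count))
    obtain rfl := List.eq_nil_of_length_eq_zero (Nat.le_zero.1 (h .adj))
    obtain rfl := List.eq_nil_of_length_eq_zero (Nat.le_zero.1 (h .adj'))
    obtain rfl := List.eq_nil_of_length_eq_zero (Nat.le_zero.1 (h .recs))
    obtain rfl := List.eq_nil_of_length_eq_zero (Nat.le_zero.1 (h .recs'))
    obtain rfl := List.eq_nil_of_length_eq_zero (Nat.le_zero.1 (h .fresh))
    obtain rfl := List.eq_nil_of_length_eq_zero (Nat.le_zero.1 (h .queue))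
    obtain rfl := List.eq_nil_of_length_eq_zero (Nat.le_zero.1 (h .rounds))
    exact .loopDone rfl rfl
  | succ N ih =>
    have htail : ∀ k, ((m.stk k).tail).length ≤ N := fun k => by
      have := h k
      rw [List.length_tail]
      omega
    cases hgo : (false || m.input.head?.isSome || m.output.head?.isSome || m.cols.head?.isSome ||
      m.cols'.head?.isSome || m.count.head?.isSome || m.adj.head?.isSome || m.adj'.head?.isSome ||
      m.recs.head?.isSome || m.recs'.head?.isSome || m.fresh.head?.isSome ||
      m.queue.head?.isSome || m.rounds.head?.isSome)
    · simp only [Bool.or_eq_false_iff, Option.isSome_eq_false_iff, Option.isNone_iff_eq_none,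
        List.head?_eq_none_iff, and_assoc, true_and] at hgo
      obtain ⟨v, l₁, l₂, l₃, l₄, l₅, l₆, l₇, l₈, l₉, l₁₀, l₁₁, l₁₂⟩ := m
      obtain ⟨rfl, rfl, rfl, rfl, rfl, rfl, rfl, rfl, rfl, rfl, rfl, rfl⟩ := hgo
      exact .mono (by omega) (.loopDone rfl rfl)
    · have h' := ih ⟨{ m.var with go := true }, m.input.tail, m.output.tail, m.cols.tail,
        m.cols'.tail, m.count.tail, m.adj.tail, m.adj'.tail, m.recs.tail, m.recs'.tail,
        m.fresh.tail, m.queue.tail, m.rounds.tail⟩ (fun k => by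
          have := htail k
          cases k <;> exact this)
      refine .mono ?_ (.loopStep ?_ ?_ (exec_skip ⟨{ m.var with go := true }, m.input.tail,
        m.output.tail, m.cols.tail, m.cols'.tail, m.count.tail, m.adj.tail, m.adj'.tail,
        m.recs.tail, m.recs'.tail, m.fresh.tail, m.queue.tail, m.rounds.tail⟩)
        (t' := 2 * N + 1) ?_)
      · omega
      · rw [← hgo]
        rfl
      · rfl
      · exact h'

/-- On rejection the rounds and the lookup are skipped, so the output is the value that `ans` had at
the start. -/
theorem ans_readAll (w : List (Option Bool)) (m : Mem) : (readAll w m).var.ans = m.var.ans := by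
  induction w generalizing m with
  | nil => rfl
  | cons x w ih =>
    rw [readAll, ih]
    obtain ⟨⟨mode, ok, sym, _, _, _, _, _, _, _, _, _, _, _, _⟩, _, _, cols, cols', _, _, _, _, _, _,
      _, _⟩ := m
    cases ok
    · rfl
    · cases mode <;> rcases x with _ | b <;> (try rfl) <;>
        first
        | (cases cols <;> rfl)
        | (cases cols' <;> rfl)

/-- The memory after the pawns have been read. -/
def loaded (A : List Bool) (b : Bool) : Mem where
  cols := A.map fun b => (b, false)
  count := (A.map fun _ => ()).reverse
  var := { ok := b }

theorem exists_eq_append_none (w : List (Option Bool)) :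
    (∃ A : List Bool, w = A.map some) ∨
      ∃ (A : List Bool) (R : List (Option Bool)), w = A.map some ++ none :: R := by
  induction w with
  | nil => exact Or.inl ⟨[], rfl⟩
  | cons x w ih =>
    rcases x with _ | b
    · exact Or.inr ⟨[], w, rfl⟩
    · rcases ih with ⟨A, rfl⟩ | ⟨A, R, rfl⟩
      · exact Or.inl ⟨b :: A, rfl⟩
      · exact Or.inr ⟨b :: A, R, rfl⟩

/-- Treats strings with and without a separator uniformly; `b` tells whether one was found and
becomes the flag `ok`. -/
theorem exec_load (w : List (Option Bool)) : ∃ (A : List Bool) (R : List (Option Bool)) (b : Bool),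
    (∃ m, Exec readPawns { input := w } m (2 * w.length + 1) ∧
      Exec initCols m { loaded A b with input := R } (2 * w.length + 2)) ∧
    A.length ≤ w.length ∧ R.length ≤ w.length ∧
    ((b = true ∧ w = A.map some ++ none :: R) ∨ (b = false ∧ w = A.map some)) := by
  rcases exists_eq_append_none w with ⟨A, rfl⟩ | ⟨A, R, rfl⟩
  · have h₁ := exec_readPawns_of_eq_map A {}
    have h₂ := exec_initCols (A.map fun b => (b, false)).reverse
      { count := (A.map fun _ => ()).reverse }
    simp only [List.append_nil, List.reverse_reverse] at h₁ h₂
    refine ⟨A, [], false, ⟨_, .mono ?_ h₁, .mono ?_ h₂⟩, ?_, ?_, Or.inr ⟨rfl, rfl⟩⟩ <;> simp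
  · have h₁ := exec_readPawns A R {}
    have h₂ := exec_initCols (A.map fun b => (b, false)).reverse
      { count := (A.map fun _ => ()).reverse, input := R, var := { sym := some none } }
    simp only [List.append_nil, List.reverse_reverse] at h₁ h₂
    refine ⟨A, R, true, ⟨_, .mono ?_ h₁, .mono ?_ h₂⟩, ?_, ?_, Or.inl ⟨rfl, rfl⟩⟩ <;>
      (simp; try omega)

/-! ### Correctness and running time of the whole program -/

/-- The bound for the running time. -/
noncomputable def time : Polynomial ℕ := 14 * .X ^ 3 + 22 * .X ^ 2 + 22 * .X + 10

theorem eval_time (n : ℕ) : time.eval n = 14 * n ^ 3 + 22 * n ^ 2 + 22 * n + 10 := by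
  simp [time]

theorem exec_answer (v : Var) (b : Bool) (h : v.ans = b) :
    Exec answer { var := v } { output := [b] } 1 := by
  subst h
  exact .block rfl

theorem exec_check (m : Mem) : Exec check m { m with
    count := m.count.tail
    var := { m.var with
      ok := m.var.ok && decide (m.var.mode = .tok) && m.var.tokSeen && m.count.head?.isNone } } 1 :=
  .block rfl

/-- The input is rejected if it is not the encoding of a pawn game with one vertex per pawn. -/
theorem exec_reject {w R : List (Option Bool)} {A : List Bool} {b : Bool} {m : Mem}
    (h₁ : Exec readPawns { input := w } m (2 * w.length + 1))
    (h₂ : Exec initCols m { loaded A b with input := R } (2 * w.length + 2))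
    (hA : A.length ≤ w.length) (hR : R.length ≤ w.length)
    (h : ¬ Accepts (readAll R (loaded A b))) :
    Exec program { input := w } { output := [false] } (time.eval w.length) := by
  have hb : Bounded (loaded A b) w.length := by
    intro k
    cases k <;> simp [loaded, Mem.stk, hA]
  have hans : (readAll R (loaded A b)).var.ans = false := ans_readAll R _
  have hb' := bounded_readAll R hb
  have h₃ := exec_readVertices R (loaded A b)
  generalize readAll R (loaded A b) = x at h hans hb' h₃
  have hok : (x.var.ok && decide (x.var.mode = .tok) && x.var.tokSeen &&
      x.count.head?.isNone) = false := by
    rw [← Bool.not_eq_true]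
    intro hok
    apply h
    simpa [Accepts, and_assoc, and_left_comm] using hok
  have h₄ := exec_check { x with input := [] }
  simp only [hok] at h₄
  have h₅ := exec_cleanup (w.length + 5 * R.length) { x with
    input := []
    count := x.count.tail
    var := { x.var with ok := false } } (fun k => by
      have := hb' k
      cases k <;> first | exact this | exact Nat.zero_le _ | exact (List.length_tail.trans_le (Nat.sub_le _ _)).trans this)
  have h₆ := exec_answer { x.var with ok := false, go := false } false hans
  refine .mono ?_ (.seq h₁ (.seq h₂ (.seq h₃ (.seq h₄ (.seq (.iteFalse rfl (exec_skip _))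
    (.seq h₅ h₆))))))
  rw [eval_time]
  nlinarith [Nat.zero_le (w.length ^ 3), Nat.zero_le (w.length ^ 2)]

theorem any_controlled {d : ℕ} (p o : Fin d → Bool) :
    controlled (((List.finRange d).map p).map fun b => (b, false)) ((List.finRange d).map o) = true ↔
      ∃ j, o j = true ∧ p j = true := by
  simp [controlled, List.zipWith_map, List.zipWith_self]

/-- The rounds compute the vertices where Player 1 wins, and the record of the initial vertex yields
the answer. -/
theorem any_answer_iff (I : Input) (hI : I.game.IsOVPP) :
    ((List.finRange I.n).reverse.map ((improve (fun v u => decide ((v, u) ∈ I.game.E))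
      (List.finRange I.n).reverse)^[2 * I.n]
        fun v => (I.row v).record (I.pawnBits.map fun b => (b, false)))).any
          VertexRecord.answer = true ↔
    I.game.optionalGrabbing.Player1Wins (.config I.token I.pawns) := by
  obtain ⟨e, he⟩ := hI
  rw [I.game.player1Wins_optionalGrabbing_iff e he]
  have key : ∀ (k : ℕ) (v : Fin I.n), ∀ r, r = ((improve (fun v u => decide ((v, u) ∈ I.game.E))
      (List.finRange I.n).reverse)^[k]
        fun v => (I.row v).record (I.pawnBits.map fun b => (b, false))) v →
      r.tok = decide (v = I.token) ∧ r.tgt = decide (v ∈ I.game.T) ∧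
      r.ctl = decide (e.symm v ∈ I.pawns) ∧
      (r.w₁ = true ↔ FrozenWin (fun v u => (v, u) ∈ I.game.E) (· ∈ I.game.T)
        (fun u => e.symm u ∈ I.pawns) k v true) ∧
      (r.w₂ = true ↔ FrozenWin (fun v u => (v, u) ∈ I.game.E) (· ∈ I.game.T)
        (fun u => e.symm u ∈ I.pawns) k v false) := by
    intro k
    induction k with
    | zero =>
      rintro v r rfl
      refine ⟨rfl, rfl, ?_, ?_, ?_⟩
      · rw [Bool.eq_iff_iff, decide_eq_true_eq]
        refine (any_controlled _ _).trans ?_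
        simp only [decide_eq_true_eq, he, Finset.mem_singleton]
        constructor
        · rintro ⟨j, rfl, hj⟩
          simpa using hj
        · exact fun h => ⟨_, by simp, h⟩
      · simp [FrozenWin, Row.record]
      · simp [FrozenWin, Row.record]
    | succ k ih =>
      rintro v r rfl
      rw [Function.iterate_succ_apply']
      generalize ((improve (fun v u => decide ((v, u) ∈ I.game.E))
        (List.finRange I.n).reverse)^[k]
          fun v => (I.row v).record (I.pawnBits.map fun b => (b, false))) = g at ih
      obtain ⟨h1, h2, h3, -⟩ := ih v _ rfl
      refine ⟨h1, h2, h3, ?_, ?_⟩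
      · simp only [improve, VertexRecord.enter₁, FrozenWin, h2, Bool.or_eq_true, decide_eq_true_eq,
          List.any_eq_true, List.mem_reverse, List.mem_finRange, true_and, Bool.and_eq_true,
          Bool.not_eq_true', (ih _ _ rfl).2.2.1, (ih _ _ rfl).2.2.2.1, (ih _ _ rfl).2.2.2.2,
          decide_eq_false_iff_not]
        simp only [imp_iff_not_or]
      · simp only [improve, VertexRecord.enter₂, FrozenWin, h2, Bool.or_eq_true, decide_eq_true_eq,
          List.any_eq_true, List.all_eq_true, List.mem_reverse, List.mem_finRange, true_and,
          Bool.and_eq_true, forall_const, Bool.not_eq_true', (ih _ _ rfl).2.2.1,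
          (ih _ _ rfl).2.2.2.1, (ih _ _ rfl).2.2.2.2, decide_eq_false_iff_not]
        simp only [imp_iff_not_or]
  have hkey := fun v => key (2 * I.n) v _ rfl
  generalize ((improve (fun v u => decide ((v, u) ∈ I.game.E))
    (List.finRange I.n).reverse)^[2 * I.n]
      fun v => (I.row v).record (I.pawnBits.map fun b => (b, false))) = g at hkey ⊢
  simp only [List.any_map, List.any_eq_true, List.mem_reverse, List.mem_finRange, true_and,
    Function.comp_apply, VertexRecord.answer, Bool.and_eq_true]
  have htok : ∀ v, (g v).tok = true ↔ v = I.token := fun v => by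
    rw [(hkey v).1, decide_eq_true_eq]
  simp only [htok, exists_eq_left]
  obtain ⟨-, -, h1, h2, h3⟩ := hkey I.token
  by_cases h : e.symm I.token ∈ I.pawns
  · simp [h1, h, h2]
  · simp [h1, h, h3]

/-- The records left in `queue` no longer matter; their number is kept for the time of `cleanup`. -/
theorem exec_main (I : Input) (hI : I.game.IsOVPP) (c : List (Bool × Bool)) (b : Bool)
    (hb : b = true ↔ I.game.optionalGrabbing.Player1Wins (.config I.token I.pawns)) :
    ∃ q : List VertexRecord, q.length = I.n ∧ Exec (iterate ⨾⨾ lookup)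
      { var := { ok := true, tokSeen := true }
        cols := c
        adj := adjStack I.rows
        recs := (I.rows.map fun r => r.record (I.pawnBits.map fun b => (b, false))).reverse
        queue := (I.rows.map fun r => r.record (I.pawnBits.map fun b => (b, false))).reverse
        rounds := List.replicate (2 * I.rows.length) () }
      { var := { ok := true, tokSeen := true, ans := b }
        cols := c
        adj := adjStack I.rows
        queue := q }
      (2 * I.n * (7 * I.n ^ 2 + 10 * I.n + 5) + 1 + (2 * I.n + 1)) := by
  -- The stacks hold rows, entries and records all in reversed order of the vertices, so reversing
  -- the list of vertices aligns them.
  have hadj : adjStack I.rows = matrix (fun v u => decide ((v, u) ∈ I.game.E))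
      (List.finRange I.n).reverse (List.finRange I.n).reverse := by
    simp [adjStack, Input.rows, matrix, List.flatMap_map, ← List.map_reverse, Input.row,
      Function.comp_def]
  have hrecs : (I.rows.map fun r => r.record (I.pawnBits.map fun b => (b, false))).reverse =
      (List.finRange I.n).reverse.map
        fun v => (I.row v).record (I.pawnBits.map fun b => (b, false)) := by
    simp [Input.rows, Function.comp_def]
  have hlen : I.rows.length = I.n := by simp [Input.rows]
  have hans := any_answer_iff I hI
  rw [← hb, ← Bool.eq_iff_iff] at hans
  rw [hadj, hrecs, hlen]
  have h₁ := exec_iterate (fun v u => decide ((v, u) ∈ I.game.E)) (List.finRange I.n).reverse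
    (fun v => (I.row v).record (I.pawnBits.map fun b => (b, false))) (2 * I.n)
    { cols := c, var := { ok := true, tokSeen := true } }
  have h₂ := fun l => exec_lookup l { cols := c
                                      adj := matrix (fun v u => decide ((v, u) ∈ I.game.E))
                                        (List.finRange I.n).reverse (List.finRange I.n).reverse
                                      queue := l
                                      var := { ok := true, tokSeen := true } }
  simp only [List.length_reverse, List.length_finRange] at h₁
  have h₃ := h₂ ((List.finRange I.n).reverse.map ((improve
    (fun v u => decide ((v, u) ∈ I.game.E)) (List.finRange I.n).reverse)^[2 * I.n]
      fun v => (I.row v).record (I.pawnBits.map fun b => (b, false))))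
  rw [hans, List.length_map, List.length_reverse, List.length_finRange] at h₃
  exact ⟨_, by simp, .seq h₁ h₃⟩

/-- The input is decided correctly if it is the encoding of a pawn game with one vertex per pawn. -/
theorem exec_accept {w R : List (Option Bool)} {A : List Bool} {m : Mem} (I : Input)
    (hI : I.game.IsOVPP) (b : Bool)
    (hb : b = true ↔ I.game.optionalGrabbing.Player1Wins (.config I.token I.pawns))
    (h₁ : Exec readPawns { input := w } m (2 * w.length + 1))
    (h₂ : Exec initCols m { loaded A true with input := R } (2 * w.length + 2))
    (hR : R.length ≤ w.length) (hA : A.length ≤ w.length) (hn : I.n = A.length)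
    (c : List (Bool × Bool)) (hc : c.length = A.length)
    (h : readAll R (loaded A true) =
      { var := { ok := true, tokSeen := true }
        cols := c
        adj := adjStack I.rows
        recs := (I.rows.map fun r => r.record (I.pawnBits.map fun b => (b, false))).reverse
        queue := (I.rows.map fun r => r.record (I.pawnBits.map fun b => (b, false))).reverse
        rounds := List.replicate (2 * I.rows.length) () }) :
    Exec program { input := w } { output := [b] } (time.eval w.length) := by
  have h₃ := exec_readVertices R (loaded A true)
  rw [h] at h₃
  have h₄ := exec_check (readAll R (loaded A true))
  rw [h] at h₄
  obtain ⟨q, hq, h₅⟩ := exec_main I hI c b hb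
  have hadj : (adjStack I.rows).length = I.n * (I.n + 1) := by
    simp [adjStack, List.length_flatMap, Input.rows, Input.row, Function.comp_def]
  have h₆ := exec_cleanup (I.n * (I.n + 1) + I.n) { var := { ok := true, tokSeen := true, ans := b }
                                                    cols := c
                                                    adj := adjStack I.rows
                                                    queue := q } (fun k => by
    cases k <;> simp [Mem.stk, hq, hadj, hc, hn])
  have h₇ := exec_answer { ok := true, tokSeen := true, ans := b } b rfl
  refine .mono ?_ (.seq h₁ (.seq h₂ (.seq h₃ (.seq h₄ (.seq (.iteTrue rfl h₅) (.seq h₆ h₇))))))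
  -- The coefficients of `time` are the sum of the costs in this run, with `I.n` and `R.length`
  -- estimated by `w.length`.
  rw [eval_time]
  have hnw : I.n ≤ w.length := hn.trans_le hA
  have h1 : I.n ^ 2 ≤ w.length ^ 2 := Nat.pow_le_pow_left hnw 2
  have h2 : I.n ^ 3 ≤ w.length ^ 3 := Nat.pow_le_pow_left hnw 3
  nlinarith

theorem exec_program (w : List (Option Bool)) (b : Bool)
    (hb : b = true ↔ w ∈ ovppOptionalGrabbingPawnGames) :
    Exec program { input := w } { output := [b] } (time.eval w.length) := by
  obtain ⟨A, R, s, ⟨m, h₁, h₂⟩, hA, hR, hs⟩ := exec_load w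
  by_cases hacc : Accepts (readAll R (loaded A s))
  · obtain ⟨rfl, hw⟩ | ⟨rfl, hw⟩ := hs
    swap
    · exact (not_accepts_readAll R rfl hacc).elim
    obtain ⟨rows, hR', hlen, hvalid, heq, htok, -⟩ := (readAll_iff
      -- This choice of `Q` yields the rows and, at the same time, the exact memory that the rounds
      -- start from.
      (Q := fun x => x = readAll R (loaded A true) ∧ Accepts x) (fun x hx => hx.2)
      (A.map fun _ => ()).reverse {} false (A.map fun b => (b, false)) [] [] [] [] R).1 ⟨rfl, hacc⟩
    rw [List.length_reverse, List.length_map] at hlen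
    have htok' : rows.any Row.tok = true := by
      rw [← heq] at hacc
      simpa using hacc.2.2.1
    obtain ⟨I, rfl, rfl⟩ := Input.exists_of_valid hvalid hlen htok'
    have hI := I.valid_iff_isOVPP.1 ⟨hvalid, hlen⟩
    have hwI : I.encode = w := by rw [hw, hR', I.encode_eq]
    simp only [htok', List.append_nil, Bool.false_or] at heq
    refine exec_accept I hI b ?_ h₁ h₂ hR hA ?_ _ ?_ heq.symm
    · rw [hb]
      constructor
      · rintro ⟨I', h1, -, h3⟩
        -- Membership in the language speaks of some input with this encoding, and injectivity makes
        -- it the one that was parsed.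
        obtain rfl := Input.encode_injective (h1.trans hwI.symm)
        exact h3
      · exact fun h => ⟨I, hwI, hI, h⟩
    · rw [← hlen]
      simp [Input.rows]
    · obtain ⟨h1, -⟩ := (valid_iff _ _ _).1 hvalid
      simp only [List.length_map] at h1
      have key : ∀ (rs : List Row) (cs : List (Bool × Bool)),
          (∀ r ∈ rs, r.own.length = cs.length) →
          (rs.foldl (fun cs r => mark cs r.own) cs).length = cs.length := by
        intro rs
        induction rs with
        | nil => exact fun cs _ => rfl
        | cons r rs ih =>
          intro cs h
          have h' := length_mark (h r (by simp))
          rw [List.foldl_cons, ih _ fun r' hr' => (h r' (by simp [hr'])).trans h'.symm, h']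
      rw [key _ _ fun r hr => by simpa using (h1 r hr).1, List.length_map]
  · have hbf : b = false := by
      rw [← Bool.not_eq_true, hb]
      rintro ⟨I, hIw, hI, -⟩
      rw [I.encode_eq] at hIw
      apply hacc
      obtain ⟨rfl, hw⟩ | ⟨rfl, hw⟩ := hs
      · obtain ⟨rfl, rfl⟩ := append_none_cons_inj (hIw.trans hw)
        obtain ⟨h1, h2⟩ := I.valid_iff_isOVPP.2 hI
        refine (readAll_iff (Q := Accepts) (fun x hx => hx) (I.pawnBits.map fun _ => ()).reverse {}
          false (I.pawnBits.map fun b => (b, false)) [] [] [] [] _).2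
            ⟨I.rows, rfl, by simpa using h2, h1, ?_⟩
        refine ⟨rfl, rfl, ?_, rfl⟩
        simp [Input.rows, Input.row]
      · have h := hIw.trans hw
        have hmem : none ∈ A.map some := by
          rw [← h]
          simp
        simp at hmem
    subst hbf
    exact exec_reject h₁ h₂ hA hR hacc

end Decider
end PawnGames

theorem mainTheorem4 :
    PawnGames.InPTIME PawnGames.ovppOptionalGrabbingPawnGames := by
  classical
  refine StackProgram.nonempty_computableInPolyTime PawnGames.Decider.program .input .output {}
    (Equiv.refl _) (Equiv.refl _) (fun w => { input := w }) (fun b => { output := [b] })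
    PawnGames.Decider.time (fun _ => rfl) (fun _ => rfl) (fun w => ?_) (fun b => ?_) (fun w => ?_)
  · funext k
    cases k <;> simp [PawnGames.Decider.Mem.stk]
  · funext k
    cases k <;> simp [PawnGames.Decider.Mem.stk, Computability.encodeBool]
  · exact PawnGames.Decider.exec_program w _ (by simp)
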